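/- All logarithms are to base $2$. A \emph{static predecessor structure} for a set $S\subseteq\{0,\dots,m-1\}$ consists of memory contents (depending on $S$) and a query program on a unit-cost word RAM that, for each $y<m$, computes $\mathrm{Pred}(y,S)=\max\{r\in S: r\le y\}$, or reports that it does not exist. Words have $O(\log m)$ bits; the operations are assignment, comparison, memory access, $+,-,\times$, integer division, shifts and bitwise Boolean operations on words. Time is the worst-case number of steps per query, and space is the number of bits of the memory contents. \textbf{The encoded representatives.} Fix constants $C_1>1$ and $C_4>0$. Let $x_1\le\dots\le x_n$ be a file of $n$ keys from $U=\{0,\dots,2^b\}$, let $s=\lceil C_4\log n\rceil$ and $\rho=\lfloor n/s\rfloor$, and let $\mathcal R=\{r_0,\dots,r_\rho\}$ with $r_0=0$, $r_\rho=2^b$ and $r_i=x_{is}$ for $0<i<\rho$. Cut $U$ into $m=\lfloor n^{C_1}\rfloor$ consecutive parts of equal size $d=\lceil(2^b+1)/m\rceil$ (the last ones possibly shorter or empty). Replacing each $r\in\mathcal R$ by the index $\lfloor r/d\rfloor$ of its part, a number of at most $C_1\log n$ bits, gives the encoding $\widetilde{\mathcal R}\subseteq\{0,\dots,m-1\}$.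 \textbf{Claim.} There are one query program, one absolute constant in the word length $O(\log m)$, and one construction (the P\u{a}tra\c{s}cu--Thorup structure) which, for all integers $\kappa\ge1$, $m\ge2$, $1\le N\le m$ and every set $S\subseteq\{0,\dots,m-1\}$ of at most $N$ keys, gives a static predecessor structure for $S$ with $$O(N2^{\kappa}\log m)\ \text{bits of space and}\quad O\Big(\max\Big\{1,\log\frac{\log m-\log N}{\kappa}\Big\}\Big)\ \text{query time},$$ with absolute constants (and $\log 0$ read as $0$). Applied to $S=\widetilde{\mathcal R}$ with $m=\lfloor n^{C_1}\rfloor$ and $N=\rho+1$, the same construction satisfies the following for all sufficiently large $n$, uniformly in $b$ and in the file, with constants in $O(\cdot)$ that depend only on $C_1$ and $C_4$. \begin{itemize} \item For every constant $\delta>0$, with $\kappa=\lfloor\delta\log n\rfloor$ (and $n$ sufficiently large depending also on $\delta$): $O(n^{1+\delta})$ bits of space and $O(\max\{1,\log\frac{C_1-1}{\delta}\})=O(1)$ query time. \item With $\kappa=\lfloor\log n/\log\log n\rfloor$: $O(n^{1+1/\log\log n})=n^{1+o(1)}$ bits of space and $O(\log\log\log n)$ query time. \item With $\kappa=1$: $O(n)$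 bits of space and $O(\log\log n)$ query time. \end{itemize} -/

import Mathlib

/-! ## A unit-cost word RAM

The query algorithms of static data structures are programs of the following machine. Words have
`w` bits and are represented by the natural numbers below `2 ^ w`. A program works on its registers
(a fixed finite number for each program) and has random access to a memory that holds the data
structure and that it does not change. Every assignment, arithmetic or bitwise operation, memory
access and comparison costs one time unit. -/

namespace WordRAM

/-- The arithmetic and bitwise operations of the machine. -/
inductive BinOp where
  | add | sub | mul | div | land | lor | xor | shl | shr

/-- The result of an operation on `w`-bit words, as a `w`-bit word. Addition, subtraction,
multiplication and left shift are modulo `2 ^ w`; division is rounded down (and gives `0` if the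
divisor is `0`). -/
def BinOp.eval (w : ℕ) : BinOp → ℕ → ℕ → ℕ
  | .add, x, y => (x + y) % 2 ^ w
  | .sub, x, y => (x + (2 ^ w - y % 2 ^ w)) % 2 ^ w
  | .mul, x, y => (x * y) % 2 ^ w
  | .div, x, y => (x / y) % 2 ^ w
  | .land, x, y => (x &&& y) % 2 ^ w
  | .lor, x, y => (x ||| y) % 2 ^ w
  | .xor, x, y => (x ^^^ y) % 2 ^ w
  | .shl, x, y => (x <<< y) % 2 ^ w
  | .shr, x, y => (x >>> y) % 2 ^ w

/-- Programs. Registers are named by natural numbers; `d`, `a`, `b` below are register names. -/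
inductive Prog where
  /-- do nothing -/
  | skip
  /-- write the constant `v` into register `d` -/
  | const (d v : ℕ)
  /-- copy register `a` into register `d` -/
  | copy (d a : ℕ)
  /-- apply an operation to the registers `a` and `b` and write the result into register `d` -/
  | op (o : BinOp) (d a b : ℕ)
  /-- write the memory word whose address is in register `a` into register `d` -/
  | load (d a : ℕ)
  /-- first `p`, then `q` -/
  | seq (p q : Prog)
  /-- if register `a` is smaller than register `b` then `p` else `q` -/
  | ifLt (a b : ℕ) (p q : Prog)
  /-- as long as register `a` is smaller than register `b`, do `p` -/
  | whileLt (a b : ℕ) (p : Prog)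

/-- `Exec w mem p r t r'`: on `w`-bit words, with memory contents `mem` (addresses outside of `mem`
read as `0`), the program `p` started with register contents `r` halts after exactly `t` steps with
register contents `r'`. -/
inductive Exec (w : ℕ) (mem : List ℕ) : Prog → (ℕ → ℕ) → ℕ → (ℕ → ℕ) → Prop where
  | skip (r : ℕ → ℕ) : Exec w mem .skip r 0 r
  | const (d v : ℕ) (r : ℕ → ℕ) :
      Exec w mem (.const d v) r 1 (Function.update r d (v % 2 ^ w))
  | copy (d a : ℕ) (r : ℕ → ℕ) :
      Exec w mem (.copy d a) r 1 (Function.update r d (r a))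
  | op (o : BinOp) (d a b : ℕ) (r : ℕ → ℕ) :
      Exec w mem (.op o d a b) r 1 (Function.update r d (o.eval w (r a) (r b)))
  | load (d a : ℕ) (r : ℕ → ℕ) :
      Exec w mem (.load d a) r 1 (Function.update r d (mem.getD (r a) 0))
  | seq {p q : Prog} {r r' r'' : ℕ → ℕ} {t t' : ℕ} :
      Exec w mem p r t r' → Exec w mem q r' t' r'' → Exec w mem (.seq p q) r (t + t') r''
  | ifTrue {a b : ℕ} {p q : Prog} {r r' : ℕ → ℕ} {t : ℕ} :
      r a < r b → Exec w mem p r t r' → Exec w mem (.ifLt a b p q) r (t + 1) r'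
  | ifFalse {a b : ℕ} {p q : Prog} {r r' : ℕ → ℕ} {t : ℕ} :
      ¬ r a < r b → Exec w mem q r t r' → Exec w mem (.ifLt a b p q) r (t + 1) r'
  | whileTrue {a b : ℕ} {p : Prog} {r r' r'' : ℕ → ℕ} {t t' : ℕ} :
      r a < r b → Exec w mem p r t r' → Exec w mem (.whileLt a b p) r' t' r'' →
      Exec w mem (.whileLt a b p) r (t + t' + 1) r''
  | whileFalse {a b : ℕ} {p : Prog} {r : ℕ → ℕ} :
      ¬ r a < r b → Exec w mem (.whileLt a b p) r 1 r

/-- The register contents at the start of a query: the query key `y` in register `0`, and `0` in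
all the others. -/
def input (y : ℕ) : ℕ → ℕ := Function.update (fun _ => 0) 0 y

/-- The answer in the registers at the end of a query: register `1` tells whether there is an
answer (`⊥` means that there is none), and register `0` holds it. -/
def output (r : ℕ → ℕ) : WithBot ℕ := if r 1 = 0 then ⊥ else ((r 0 : ℕ) : WithBot ℕ)

end WordRAM

/-! ## Static predecessor structures -/

/-- The predecessor of `y` in `S`: the largest element of `S` that is at most `y`, or `⊥` if there
is none. -/
def pred (S : Finset ℕ) (y : ℕ) : WithBot ℕ := (S.filter (· ≤ y)).max

/-- The memory contents `mem`, made of `w`-bit words, together with the query program `query`, solve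
the static predecessor problem for the set `S` of keys from the universe `{0, …, m - 1}`, with at
most `T` steps per query. -/
def SolvesPred (query : WordRAM.Prog) (w m : ℕ) (S : Finset ℕ) (mem : List ℕ) (T : ℝ) : Prop :=
  (∀ v ∈ mem, v < 2 ^ w) ∧
    ∀ y < m, ∃ (t : ℕ) (r : ℕ → ℕ), WordRAM.Exec w mem query (WordRAM.input y) t r ∧
      WordRAM.output r = pred S y ∧ (t : ℝ) ≤ T

/-- The space, in bits, of memory contents made of `w`-bit words. -/
def spaceBits (w : ℕ) (mem : List ℕ) : ℕ := mem.length * w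

/-- The word length: `c` times the number of bits of a key from `{0, …, m - 1}`. -/
def wordLength (c m : ℕ) : ℕ := c * Nat.clog 2 m

/-- In words of `wordLength c m` bits, the memory contents `mem` occupy at most `B` bits and, with
the program `query`, solve the static predecessor problem for the set `S` of keys from
`{0, …, m - 1}` in at most `T` steps per query. -/
def IsPredStructure (query : WordRAM.Prog) (c m : ℕ) (S : Finset ℕ) (mem : List ℕ) (B T : ℝ) :
    Prop :=
  (spaceBits (wordLength c m) mem : ℝ) ≤ B ∧ SolvesPred query (wordLength c m) m S mem T

/-! ## The representatives of a file and their encoding -/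

/-- `x 1 ≤ x 2 ≤ … ≤ x n` is a file of `n` keys from the universe `{0, …, 2 ^ b}`, in increasing
order. -/
def IsSortedFile (n b : ℕ) (x : ℕ → ℕ) : Prop :=
  MonotoneOn x (Set.Icc 1 n) ∧ ∀ i ∈ Set.Icc 1 n, x i ≤ 2 ^ b

/-- The distance `C₄ log n` (rounded up) between the ranks of consecutive representatives. -/
noncomputable def repGap (C₄ : ℝ) (n : ℕ) : ℕ := ⌈C₄ * Real.logb 2 n⌉₊

/-- The number `ρ` of buckets: there are `ρ + 1` representatives `r 0, …, r ρ`. -/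
noncomputable def numBuckets (C₄ : ℝ) (n : ℕ) : ℕ := n / repGap C₄ n

/-- The set of the representatives: `r 0 = 0` and `r ρ = 2 ^ b` are the end points of the universe,
and `r i`, for `0 < i < ρ`, is the key of rank `i * repGap C₄ n`. -/
noncomputable def representatives (C₄ : ℝ) (n b : ℕ) (x : ℕ → ℕ) : Finset ℕ :=
  insert 0 (insert (2 ^ b)
    ((Finset.Ioo 0 (numBuckets C₄ n)).image fun i => x (i * repGap C₄ n)))

/-- The number `n ^ C₁` (rounded down) of parts into which the universe is partitioned, so that
the index of a part takes `C₁ log n` bits. -/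
noncomputable def numParts (C₁ : ℝ) (n : ℕ) : ℕ := ⌊(n : ℝ) ^ C₁⌋₊

/-- The number of elements of each part when `{0, …, 2 ^ b}` is cut into `m` consecutive intervals
of equal size (rounded up, so that the last ones may be shorter or empty). -/
def partSize (b m : ℕ) : ℕ := (2 ^ b + 1) ⌈/⌉ m

/-- The encoding of the representatives: each one is replaced by the index of the part in which it
lies. -/
noncomputable def encodedReps (C₁ C₄ : ℝ) (n b : ℕ) (x : ℕ → ℕ) : Finset ℕ :=
  (representatives C₄ n b x).image fun y => y / partSize b (numParts C₁ n)

/-!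
The data structure is a trie over `κ` bits at a time, cut off at the top and searched by bisection
on the depth. Let `pfx κ j x` be the key `x` without its last `κ * j` bits. Choose the number `L` of
levels least with `m ≤ N * 2 ^ (κ * L)`: then there are at most `N` prefixes of level `L`, and `L`
is about `(log m - log N) / κ`.

*Reduction to branching.* A prefix of level `j` branches if two keys of `S` have it and differ on
level `j - 1`. If `A` is the lowest level on which the prefix of `y` branches (or `L + 1`), then the
keys of `S` sharing the prefix of `y` of level `A - 1` lie all above `y` or all at or below `y`.
Hence the predecessor of `y` is one of two numbers that depend on that prefix only, and comparing
`y` with the larger one tells which (`predCode_eq_of_no_branch`). The prefixes at which these two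
numbers must be stored are the at most `N` ones of level `L` and the children of the branching
prefixes. There are at most `|S|` branching prefixes, since each one is opened by a key of `S` that
opens no other (`Branch.exists_opens`, `Opens.unique`), so at most `N + N * 2 ^ κ` pairs of numbers
are stored.

*The search for `A`.* This is the fat binary search of z-fast tries. Between a branching prefix on
level `j` and the next branching prefix above it, the level divisible by the highest power of two is
the handle (`Handle`), and the prefix of that level points to the branching prefix. For decreasing
powers `P` of two, the search keeps an interval `[B, A)` of possible levels that contains at most
one multiple of `P`, and probes that multiple: by `exists_handle` and `Handle.pfx_eq`, a probe which
does not find a branching prefix of `y` proves that there is none on the levels up to the probed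
one. So `log L + 1` probes suffice, and each takes constant time.

*The dictionary.* All the stored records sit in one hash table of linear size, with the two-level
perfect hashing of Fredman, Komlós and Szemerédi (`exists_perfect_hash`). Keys need not be stored:
a probe for an absent key returns a void record or that of some branching prefix, which is harmless,
because the search checks whether that is a prefix of `y`.

If `κ` exceeds the number of bits of a key, that number of bits is used in place of `κ`, so that all
parameters fit into a word. The bounds for the encoded representatives follow from
`N * log m = O(n)` and `log m - log N ≤ (C₁ - 1) log n + log log n + O(1)`.
-/

/-! ### Prefixes and branching -/

section Trie

/-- The prefix of level `j` of the key `x`: the key without its `κ * j` lowest bits. -/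
def pfx (κ j x : ℕ) : ℕ := x / 2 ^ (κ * j)

lemma pfx_zero (κ x : ℕ) : pfx κ 0 x = x := by simp [pfx]

lemma pfx_le_self (κ j x : ℕ) : pfx κ j x ≤ x := Nat.div_le_self _ _

lemma pfx_mono (κ j : ℕ) {x y : ℕ} (h : x ≤ y) : pfx κ j x ≤ pfx κ j y :=
  Nat.div_le_div_right h

lemma pfx_succ (κ j x : ℕ) : pfx κ (j + 1) x = pfx κ j x / 2 ^ κ := by
  unfold pfx
  rw [Nat.div_div_eq_div_mul, ← pow_add, mul_add, mul_one]

lemma pfx_eq_of_le {κ j k x y : ℕ} (h : j ≤ k) (e : pfx κ j x = pfx κ j y) :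
    pfx κ k x = pfx κ k y := by
  induction k, h using Nat.le_induction with
  | base => exact e
  | succ k _ ih => rw [pfx_succ, pfx_succ, ih]

/-- Two different keys with a common prefix have a lowest level on which their prefixes agree. -/
lemma exists_meet {κ f x y : ℕ} (hf : pfx κ f x = pfx κ f y) (hxy : x ≠ y) :
    ∃ k, 1 ≤ k ∧ k ≤ f ∧ pfx κ k x = pfx κ k y ∧ pfx κ (k - 1) x ≠ pfx κ (k - 1) y := by
  classical
  have hex : ∃ k, pfx κ k x = pfx κ k y := ⟨f, hf⟩
  have h0 : Nat.find hex ≠ 0 := by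
    intro h
    have := Nat.find_spec hex
    rw [h, pfx_zero, pfx_zero] at this
    exact hxy this
  exact ⟨Nat.find hex, by omega, Nat.find_min' hex hf, Nat.find_spec hex,
    Nat.find_min hex (by omega)⟩

/-- The prefix of level `j` of `z` branches: two keys of `S` have this prefix and differ in the next
`κ` bits. The key `z` itself need not belong to `S`. -/
def Branch (κ : ℕ) (S : Finset ℕ) (j z : ℕ) : Prop :=
  1 ≤ j ∧ ∃ a ∈ S, ∃ c ∈ S, pfx κ j a = pfx κ j z ∧ pfx κ j c = pfx κ j z ∧
    pfx κ (j - 1) a ≠ pfx κ (j - 1) c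

/-- The key `b` of `S` makes its prefix of level `j` branching: smaller keys of `S` have that
prefix, but `b` is the first key of `S` with its prefix of level `j - 1`. -/
def Opens (κ : ℕ) (S : Finset ℕ) (j b : ℕ) : Prop :=
  b ∈ S ∧ 1 ≤ j ∧ (∀ x ∈ S, x < b → pfx κ (j - 1) x < pfx κ (j - 1) b) ∧
    ∃ x ∈ S, x < b ∧ pfx κ j x = pfx κ j b

variable {κ L : ℕ} {S : Finset ℕ}

lemma Branch.congr {j y z : ℕ} (h : Branch κ S j y) (e : pfx κ j y = pfx κ j z) :
    Branch κ S j z := by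
  obtain ⟨h1, a, ha, c, hc, h2, h3, h4⟩ := h
  exact ⟨h1, a, ha, c, hc, h2.trans e, h3.trans e, h4⟩

lemma Opens.branch {j b : ℕ} (h : Opens κ S j b) : Branch κ S j b := by
  obtain ⟨hb, h1, h2, x, hx, hxb, e⟩ := h
  exact ⟨h1, x, hx, b, hb, e, rfl, (h2 x hx hxb).ne⟩

lemma Opens.le {j j' b : ℕ} (h : Opens κ S j b) (h' : Opens κ S j' b) : j' ≤ j := by
  by_contra! hlt
  obtain ⟨-, -, -, x, hx, hxb, e⟩ := h
  exact (h'.2.2.1 x hx hxb).ne (pfx_eq_of_le (by omega) e)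

lemma Opens.unique {j j' b : ℕ} (h : Opens κ S j b) (h' : Opens κ S j' b) : j = j' :=
  le_antisymm (h'.le h) (h.le h')

/-- A branching prefix is opened by the first key that leaves the prefix of level `j - 1` of the
smaller one of two keys witnessing the branching. -/
lemma Branch.exists_opens {j z : ℕ} (h : Branch κ S j z) :
    ∃ b, Opens κ S j b ∧ pfx κ j b = pfx κ j z := by
  obtain ⟨h1, a, ha, c, hc, h2, h3, h4⟩ := h
  wlog hac : pfx κ (j - 1) a < pfx κ (j - 1) c generalizing a c
  · exact this c hc a ha h3 h2 h4.symm (lt_of_le_of_ne (not_lt.1 hac) h4.symm)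
  have hne : (S.filter fun x => pfx κ (j - 1) a < pfx κ (j - 1) x).Nonempty :=
    ⟨c, by simp [hc, hac]⟩
  set b := (S.filter fun x => pfx κ (j - 1) a < pfx κ (j - 1) x).min' hne with hb
  have hbm := Finset.min'_mem _ hne
  rw [← hb, Finset.mem_filter] at hbm
  have hbc : b ≤ c := Finset.min'_le _ _ (by simp [hc, hac])
  have hab : a < b := by
    by_contra! hba
    exact absurd (pfx_mono κ (j - 1) hba) (not_le.2 hbm.2)
  have hbz : pfx κ j b = pfx κ j z :=
    le_antisymm (h3 ▸ pfx_mono κ j hbc) (h2 ▸ pfx_mono κ j hab.le)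
  refine ⟨b, ⟨hbm.1, h1, fun x hx hxb => ?_, a, ha, hab, h2.trans hbz.symm⟩, hbz⟩
  by_contra! hle
  have hxm : x ∈ S.filter fun x => pfx κ (j - 1) a < pfx κ (j - 1) x := by
    simp [hx, lt_of_lt_of_le hbm.2 hle]
  exact absurd (Finset.min'_le _ _ hxm) (not_le.2 hxb)

/-- `f` is the handle of the branching prefix of level `j` of `b`. The levels `g` with no branching
above `j` up to `g` form an interval starting at `j`, and `f` is the only multiple of some power of
two in it. The branching prefix is represented by the key `b` that opens it. -/
def Handle (κ : ℕ) (S : Finset ℕ) (L j b f : ℕ) : Prop :=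
  Opens κ S j b ∧ j ≤ f ∧ f ≤ L ∧ (∀ i, j < i → i ≤ f → ¬ Branch κ S i b) ∧
    ∃ e, 2 ^ e ∣ f ∧ ∀ g, j ≤ g → g ≤ L → g ≠ f → (∀ i, j < i → i ≤ g → ¬ Branch κ S i b) →
      ¬ 2 ^ e ∣ g

lemma Handle.unique {j j' b f f' : ℕ} (h : Handle κ S L j b f) (h' : Handle κ S L j' b f') :
    j = j' ∧ f = f' := by
  obtain rfl := h.1.unique h'.1
  refine ⟨rfl, ?_⟩
  obtain ⟨-, h1, h2, h3, e, h4, h5⟩ := h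
  obtain ⟨-, h1', h2', h3', e', h4', h5'⟩ := h'
  by_contra hne
  rcases le_total e e' with hee | hee
  · exact h5 f' h1' h2' (Ne.symm hne) h3' ((pow_dvd_pow 2 hee).trans h4')
  · exact h5' f h1 h2 hne h3 ((pow_dvd_pow 2 hee).trans h4)

/-- Suppose that the prefixes of `y` do not branch below level `B`, that the one of level `A` does
unless `A = L + 1`, and that `f` is the only multiple of `2 ^ e` in `[B, A)`. If some prefix of `y`
branches on a level at most `f`, then the prefix of `y` of level `f` is the handle of a branching
prefix, namely of the one on the highest such level. -/
lemma exists_handle {A B e f y : ℕ} (hA : A = L + 1 ∨ Branch κ S A y) (hAL : A ≤ L + 1)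
    (hB : ∀ i < B, ¬ Branch κ S i y) (hfA : f < A)
    (hdvd : 2 ^ e ∣ f) (hmul : ∀ g, B ≤ g → g < A → g ≠ f → ¬ 2 ^ e ∣ g)
    (hbr : ∃ i ≤ f, Branch κ S i y) :
    ∃ j b, Handle κ S L j b f ∧ pfx κ f b = pfx κ f y := by
  classical
  obtain ⟨i₀, hi₀, hi₀b⟩ := hbr
  set i := Nat.findGreatest (fun i => Branch κ S i y) f with hi
  have hib : Branch κ S i y := Nat.findGreatest_spec (P := fun i => Branch κ S i y) hi₀ hi₀b
  have hif : i ≤ f := Nat.findGreatest_le _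
  obtain ⟨b, hb, hby⟩ := hib.exists_opens
  refine ⟨i, b, ⟨hb, hif, by omega, fun k hik hkf hk => ?_, e, hdvd,
    fun g hig hgL hgf hg => ?_⟩, pfx_eq_of_le hif hby⟩
  · exact Nat.findGreatest_is_greatest hik hkf (hk.congr (pfx_eq_of_le hik.le hby))
  · refine hmul g ?_ ?_ hgf
    · by_contra! hlt
      exact hB i (by omega) hib
    · by_contra! hle
      rcases hA with hA | hA
      · omega
      · exact hg A (by omega) hle (hA.congr (pfx_eq_of_le (by omega) hby.symm))

/-- If the handle `f` of the branching prefix of `b` is probed with `y`, and `y` has a branching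
prefix on a level at most `f`, then the branching prefix of `b` is a prefix of `y`: otherwise the
two paths would separate at a branching level between `j` and `f`. -/
lemma Handle.pfx_eq {j b f y : ℕ} (h : Handle κ S L j b f) (hf : pfx κ f b = pfx κ f y)
    (hbr : ∃ i ≤ f, Branch κ S i y) : pfx κ j b = pfx κ j y := by
  by_contra hne
  obtain ⟨i, hif, hi⟩ := hbr
  obtain ⟨hb, hjf, -, hno, -⟩ := h
  have hby : b ≠ y := by rintro rfl; exact hne rfl
  obtain ⟨k, hk1, hkf, hk, hk'⟩ := exists_meet hf hby
  have hjk : j < k := by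
    by_contra! hkj
    exact hne (pfx_eq_of_le hkj hk)
  rcases lt_or_ge i k with hik | hki
  · obtain ⟨-, a, ha, -, -, hai, -, -⟩ := hi
    refine hno k hjk hkf ⟨hk1, a, ha, b, hb.1, ?_, rfl, ?_⟩
    · rw [pfx_eq_of_le hik.le hai, hk]
    · rw [pfx_eq_of_le (by omega : i ≤ k - 1) hai]
      exact hk'.symm
  · exact hno i (by omega) hif (hi.congr (pfx_eq_of_le hki hk).symm)

/-- The predecessor of `y` in `S` plus one, and `0` if there is none. -/
def predCode (S : Finset ℕ) (y : ℕ) : ℕ := (S.filter (· ≤ y)).sup (· + 1)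

/-- Below the lowest branching level `A`, the predecessor of `y` is the largest key whose prefix of
level `A - 1` is at most the one of `y`, if that key is at most `y`; otherwise all the keys with the
prefix of `y` exceed `y`, and the predecessor is the largest key with a smaller prefix. -/
lemma predCode_eq_of_no_branch {A y : ℕ} (hA : 1 ≤ A) (h : ∀ i < A, ¬ Branch κ S i y) :
    predCode S y =
      if (S.filter fun x => pfx κ (A - 1) x ≤ pfx κ (A - 1) y).sup (· + 1) ≤ y + 1 then
        (S.filter fun x => pfx κ (A - 1) x ≤ pfx κ (A - 1) y).sup (· + 1)
      else (S.filter fun x => pfx κ (A - 1) x < pfx κ (A - 1) y).sup (· + 1) := by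
  unfold predCode
  split_ifs with hhi
  · congr 1
    ext x
    simp only [Finset.mem_filter, and_congr_right_iff]
    refine fun hx => ⟨fun hxy => pfx_mono _ _ hxy, fun hxy => ?_⟩
    have : x + 1 ≤ y + 1 := le_trans (Finset.le_sup (f := (· + 1)) (by simp [hx, hxy])) hhi
    omega
  · have hb : ∃ b ∈ S, pfx κ (A - 1) b ≤ pfx κ (A - 1) y ∧ y < b := by
      by_contra! hcon
      refine hhi (Finset.sup_le fun x hx => ?_)
      rw [Finset.mem_filter] at hx
      have := hcon x hx.1 hx.2
      omega
    obtain ⟨b, hb, hby, hyb⟩ := hb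
    have hby' : pfx κ (A - 1) b = pfx κ (A - 1) y := le_antisymm hby (pfx_mono _ _ hyb.le)
    congr 1
    ext x
    simp only [Finset.mem_filter, and_congr_right_iff]
    refine fun hx => ⟨fun hxy => lt_of_le_of_ne (pfx_mono _ _ hxy) fun he => ?_, fun hxy => ?_⟩
    · obtain ⟨k, hk1, hkA, hk, hk'⟩ := exists_meet (he.trans hby'.symm) (by omega : x ≠ b)
      have hyk : pfx κ k x = pfx κ k y :=
        le_antisymm (pfx_mono _ _ hxy) (hk ▸ pfx_mono _ _ hyb.le)
      exact h k (by omega) ⟨hk1, x, hx, b, hb, hyk, hk ▸ hyk, hk'⟩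
    · by_contra! hlt
      exact absurd (pfx_mono κ (A - 1) hlt.le) (not_le.2 hxy)

lemma pred_eq_predCode (S : Finset ℕ) (y : ℕ) :
    pred S y = if predCode S y = 0 then ⊥ else ((predCode S y - 1 : ℕ) : WithBot ℕ) := by
  unfold pred predCode
  rcases (S.filter (· ≤ y)).eq_empty_or_nonempty with h | h
  · simp [h]
  · obtain ⟨M, hM⟩ := Finset.max_of_nonempty h
    have : (S.filter (· ≤ y)).sup (· + 1) = M + 1 := by
      refine le_antisymm (Finset.sup_le fun x hx => ?_)
        (Finset.le_sup (f := (· + 1)) (Finset.mem_of_max hM))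
      have := Finset.le_max_of_eq hx hM
      omega
    rw [hM, this]
    simp
    rfl

end Trie

/-! ### Two-level perfect hashing -/

open Finset in
/-- Multiplication modulo a prime is almost universal. If `a` makes `x` and `y` collide, then the
difference of the residues of `a * x` and `a * y` is a nonzero multiple of `s` between `-p` and `p`;
there are at most `2 * ((p - 1) / s)` of these, and each determines `a`. -/
lemma card_mul_collisions_le {p x y s : ℕ} (hp : p.Prime) (hx : x < p) (hy : y < p)
    (hxy : x ≠ y) :
    #{a ∈ Icc 1 (p - 1) | (a * x % p) % s = (a * y % p) % s} * s ≤ 2 * (p - 1) := by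
  rcases Nat.eq_zero_or_pos s with rfl | hs
  · simp
  have hp0 := hp.pos
  have hdiv : ∀ a : ℕ, (p : ℤ) ∣
      (a : ℤ) * ((x : ℤ) - y) - (((a * x % p : ℕ) : ℤ) - (a * y % p : ℕ)) := by
    intro a
    have h1 : (p : ℤ) ∣ (a * x : ℕ) - ((a * x % p : ℕ) : ℤ) := by
      rw [Int.natCast_mod]; exact Int.dvd_self_sub_emod
    have h2 : (p : ℤ) ∣ (a * y : ℕ) - ((a * y % p : ℕ) : ℤ) := by
      rw [Int.natCast_mod]; exact Int.dvd_self_sub_emod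
    have h3 := dvd_sub h1 h2
    rw [Nat.cast_mul, Nat.cast_mul] at h3
    rwa [mul_sub, sub_sub_sub_comm]
  have hcop : ∀ c : ℤ, (p : ℤ) ∣ c * ((x : ℤ) - y) → (p : ℤ) ∣ c := by
    intro c hc
    rcases (Nat.prime_iff_prime_int.1 hp).dvd_or_dvd hc with h | h
    · exact h
    · exfalso
      obtain h := Int.eq_zero_of_abs_lt_dvd h (by rw [abs_lt]; omega)
      omega
  have hlt : ∀ a ∈ Icc 1 (p - 1), ∀ a' ∈ Icc 0 (p - 1), (p : ℤ) ∣ (a : ℤ) - a' → a = a' := by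
    intro a ha a' ha' h
    rw [mem_Icc] at ha ha'
    have := Int.eq_zero_of_abs_lt_dvd h (by rw [abs_lt]; omega)
    omega
  let g : ℕ → ℤ := fun a => (((a * x % p : ℕ) : ℤ) - (a * y % p : ℕ)) / s
  have hg : ∀ a ∈ {a ∈ Icc 1 (p - 1) | (a * x % p) % s = (a * y % p) % s},
      g a * s = ((a * x % p : ℕ) : ℤ) - (a * y % p : ℕ) := by
    intro a ha
    rw [mem_filter] at ha
    refine Int.ediv_mul_cancel ?_
    exact (Nat.modEq_iff_dvd.1 (show (a * y % p) ≡ (a * x % p) [MOD s] from ha.2.symm))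
  have hcard : #{a ∈ Icc 1 (p - 1) | (a * x % p) % s = (a * y % p) % s} ≤
      #((Icc (-(((p - 1) / s : ℕ) : ℤ)) ((p - 1) / s : ℕ)).erase 0) := by
    refine card_le_card_of_injOn g (fun a ha => ?_) (fun a ha a' ha' hgg => ?_)
    · have e := hg a ha
      rw [mem_coe, mem_filter] at ha
      have h1 := Nat.mod_lt (a * x) hp0
      have h2 := Nat.mod_lt (a * y) hp0
      rw [mem_coe, mem_erase, mem_Icc]
      have hs' : (0 : ℤ) < s := by exact_mod_cast hs
      refine ⟨fun h0 => ?_, ?_, ?_⟩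
      · rw [h0, zero_mul] at e
        have := hdiv a
        rw [← e, sub_zero] at this
        have := hlt a ha.1 0 (by simp) (by simpa using hcop _ this)
        have := (mem_Icc.1 ha.1).1
        omega
      · have : -g a ≤ ((p - 1 : ℕ) : ℤ) / s := by
          rw [Int.le_ediv_iff_mul_le hs', neg_mul, e]; omega
        push_cast at this ⊢
        omega
      · have : g a ≤ ((p - 1 : ℕ) : ℤ) / s := by
          rw [Int.le_ediv_iff_mul_le hs', e]; omega
        push_cast at this ⊢
        omega
    · have e := hg a ha
      have e' := hg a' ha'
      rw [hgg, e'] at e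
      rw [mem_coe, mem_filter] at ha ha'
      have h1 := dvd_sub (hdiv a) (hdiv a')
      rw [e] at h1
      refine hlt a ha.1 a' ?_ (hcop _ ?_)
      · have := mem_Icc.1 ha'.1
        simp [this.2]
      · rwa [sub_sub_sub_cancel_right, ← sub_mul] at h1
  have ht : (0 : ℤ) ≤ ((p - 1) / s : ℕ) := Int.natCast_nonneg _
  have hc2 : #((Icc (-(((p - 1) / s : ℕ) : ℤ)) ((p - 1) / s : ℕ)).erase 0) =
      2 * ((p - 1) / s) := by
    rw [card_erase_of_mem (mem_Icc.2 ⟨neg_nonpos.2 ht, ht⟩), Int.card_Icc]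
    omega
  rw [hc2] at hcard
  calc _ ≤ 2 * ((p - 1) / s) * s := Nat.mul_le_mul_right s hcard
    _ = 2 * ((p - 1) / s * s) := by ring
    _ ≤ 2 * (p - 1) := by gcongr; exact Nat.div_mul_le_self _ _

open Finset in
/-- Some multiplier has at most the average number of collisions. -/
lemma exists_few_collisions {p : ℕ} (hp : p.Prime) {K : Finset ℕ} (hK : ∀ x ∈ K, x < p) (s : ℕ) :
    ∃ a < p, #{q ∈ K.offDiag | (a * q.1 % p) % s = (a * q.2 % p) % s} * s ≤ 2 * #K.offDiag := by
  have hne : (Icc 1 (p - 1)).Nonempty := by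
    have := hp.two_le
    exact ⟨1, by simp; omega⟩
  have hsum : ∑ a ∈ Icc 1 (p - 1),
      #{q ∈ K.offDiag | (a * q.1 % p) % s = (a * q.2 % p) % s} * s ≤
      ∑ a ∈ Icc 1 (p - 1), 2 * #K.offDiag := by
    rw [← sum_mul]
    simp_rw [card_filter]
    rw [sum_comm, sum_mul]
    calc _ ≤ ∑ q ∈ K.offDiag, 2 * (p - 1) := by
          refine sum_le_sum fun q hq => ?_
          rw [mem_offDiag] at hq
          have := card_mul_collisions_le (s := s) hp (hK _ hq.1) (hK _ hq.2.1) hq.2.2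
          rwa [card_filter] at this
      _ = _ := by
          simp only [sum_const, Nat.card_Icc, smul_eq_mul, Nat.add_sub_cancel]
          ring
  obtain ⟨a, ha, h⟩ := exists_le_of_sum_le hne hsum
  rw [mem_Icc] at ha
  exact ⟨a, by have := hp.two_le; omega, h⟩

open Finset in
/-- The scheme of Fredman, Komlós and Szemerédi: the first level distributes the keys over `M`
buckets with `O(M)` collisions in total, and a bucket of `k` keys gets its own multiplier `A i`, its
own offset `O i`, and `s i = 2 * k ^ 2 + 1` cells, enough to avoid all collisions. -/
lemma exists_perfect_hash {p M : ℕ} (hp : p.Prime) {K : Finset ℕ} (hK : ∀ x ∈ K, x < p)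
    (hKM : #K ≤ M) (hM : 0 < M) :
    ∃ (a : ℕ) (A O s : ℕ → ℕ), a < p ∧ (∀ i < M, A i < p) ∧ (∀ i < M, 0 < s i) ∧
      (∀ i < M, O i + s i ≤ 7 * M) ∧
      Set.InjOn (fun x => O (a * x % p % M) + A (a * x % p % M) * x % p % s (a * x % p % M))
        (K : Set ℕ) := by
  obtain ⟨a, ha, hcoll⟩ := exists_few_collisions hp hK M
  set h : ℕ → ℕ := fun x => a * x % p % M with hh
  have hhM : ∀ x, h x < M := fun x => Nat.mod_lt _ hM
  set B : ℕ → Finset ℕ := fun i => K.filter fun x => h x = i with hB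
  set s : ℕ → ℕ := fun i => 2 * #(B i) ^ 2 + 1 with hs
  have hsec : ∀ i, ∃ c < p, Set.InjOn (fun x => c * x % p % s i) (B i : Set ℕ) := by
    intro i
    obtain ⟨c, hc, hcc⟩ := exists_few_collisions hp
      (K := B i) (fun x hx => hK x (mem_filter.1 hx).1) (s i)
    refine ⟨c, hc, fun x hx y hy hxy => ?_⟩
    by_contra hne
    have hpos : 0 < #{q ∈ (B i).offDiag | (c * q.1 % p) % s i = (c * q.2 % p) % s i} :=
      card_pos.2 ⟨(x, y), by
        rw [mem_filter, mem_offDiag]; exact ⟨⟨hx, hy, hne⟩, hxy⟩⟩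
    rw [offDiag_card] at hcc
    have : 1 * s i ≤ 2 * (#(B i) * #(B i) - #(B i)) := le_trans (Nat.mul_le_mul_right _ hpos) hcc
    simp only [hs, sq] at this
    omega
  choose A hA hAinj using hsec
  -- The squares of the bucket sizes count the colliding pairs, the diagonal included.
  have hsq : ∑ i ∈ range M, #(B i) ^ 2 ≤ #K +
      #{q ∈ K.offDiag | (a * q.1 % p) % M = (a * q.2 % p) % M} := by
    have h1 : ∑ i ∈ range M, #(B i) ^ 2 = #{q ∈ K ×ˢ K | h q.1 = h q.2} := by
      rw [card_eq_sum_card_fiberwise (f := fun q => h q.1) (t := range M)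
        (fun q _ => by simp [hhM])]
      refine sum_congr rfl fun i _ => ?_
      rw [sq, ← card_product]
      congr 1
      ext ⟨x, y⟩
      simp only [hB, mem_product, mem_filter]
      constructor
      · rintro ⟨⟨h1, h2⟩, h3, h4⟩; exact ⟨⟨⟨h1, h3⟩, h2.trans h4.symm⟩, h2⟩
      · rintro ⟨⟨⟨h1, h3⟩, h2⟩, h4⟩; exact ⟨⟨h1, h4⟩, h3, h2 ▸ h4⟩
    rw [h1, ← diag_card K, ← card_union_of_disjoint]
    · refine card_le_card fun ⟨x, y⟩ hq => ?_
      simp only [mem_filter, mem_product] at hq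
      simp only [mem_union, mem_diag, mem_filter, mem_offDiag]
      by_cases hxy : x = y
      · exact Or.inl ⟨hq.1.1, hxy⟩
      · exact Or.inr ⟨⟨hq.1.1, hq.1.2, hxy⟩, hq.2⟩
    · exact (disjoint_diag_offDiag K).mono_right (filter_subset _ _)
  have hc2 : #{q ∈ K.offDiag | (a * q.1 % p) % M = (a * q.2 % p) % M} ≤ 2 * M := by
    refine Nat.le_of_mul_le_mul_right (le_trans hcoll ?_) hM
    rw [offDiag_card]
    calc 2 * (#K * #K - #K) ≤ 2 * (#K * #K) := by gcongr; exact Nat.sub_le _ _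
      _ ≤ 2 * (M * M) := by gcongr
      _ = _ := by ring
  have htot : ∑ i ∈ range M, s i ≤ 7 * M := by
    simp only [hs, sum_add_distrib, ← mul_sum, sum_const, card_range, smul_eq_mul]
    omega
  refine ⟨a, A, fun i => ∑ k ∈ range i, s k, s, ha, fun i _ => hA i, fun i _ => by simp [hs],
    fun i hi => ?_, fun x hx y hy hxy => ?_⟩
  · rw [← sum_range_succ]
    exact le_trans (sum_le_sum_of_subset (range_subset_range.2 hi)) htot
  · have hxlt : A (h x) * x % p % s (h x) < s (h x) := Nat.mod_lt _ (by simp [hs])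
    have hylt : A (h y) * y % p % s (h y) < s (h y) := Nat.mod_lt _ (by simp [hs])
    change ∑ k ∈ range (h x), s k + A (h x) * x % p % s (h x) =
      ∑ k ∈ range (h y), s k + A (h y) * y % p % s (h y) at hxy
    have hmon : ∀ i j, i < j → ∑ k ∈ range i, s k + s i ≤ ∑ k ∈ range j, s k := by
      intro i j hij
      rw [← sum_range_succ]
      exact sum_le_sum_of_subset (range_subset_range.2 hij)
    have hxy' : h x = h y := by
      rcases lt_trichotomy (h x) (h y) with hlt | heq | hgt
      · have := hmon _ _ hlt; omega
      · exact heq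
      · have := hmon _ _ hgt; omega
    rw [hxy'] at hxy
    refine hAinj (h y) ?_ ?_ (Nat.add_left_cancel hxy)
    · exact mem_coe.2 (mem_filter.2 ⟨hx, hxy'⟩)
    · exact mem_coe.2 (mem_filter.2 ⟨hy, rfl⟩)

/-! ### Running programs -/

namespace WordRAM

/-- Started with the registers `r`, the program `p` halts within `T` steps with registers
satisfying `Q`. -/
def Runs (w : ℕ) (mem : List ℕ) (p : Prog) (r : ℕ → ℕ) (T : ℕ) (Q : (ℕ → ℕ) → Prop) : Prop :=
  ∃ t r', Exec w mem p r t r' ∧ t ≤ T ∧ Q r'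

/-- Execution of a list of programs one after the other. -/
def seqs : List Prog → Prog
  | [] => .skip
  | p :: ps => .seq p (seqs ps)

variable {w : ℕ} {mem : List ℕ} {r : ℕ → ℕ} {T T' : ℕ} {Q Q' : (ℕ → ℕ) → Prop} {ps : List Prog}
  {p q : Prog} {a b d v : ℕ}

lemma Runs.mono (h : Runs w mem p r T Q) (hT : T ≤ T') (hQ : ∀ r', Q r' → Q' r') :
    Runs w mem p r T' Q' := by
  obtain ⟨t, r', h1, h2, h3⟩ := h
  exact ⟨t, r', h1, h2.trans hT, hQ _ h3⟩

lemma runs_nil (h : Q r) : Runs w mem (seqs []) r 0 Q := ⟨0, r, .skip r, le_rfl, h⟩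

lemma runs_cons (h : Runs w mem p r T fun r' => Runs w mem (seqs ps) r' T' Q) :
    Runs w mem (seqs (p :: ps)) r (T' + T) Q := by
  obtain ⟨t, r', h1, h2, t', r'', h3, h4, h5⟩ := h
  exact ⟨t + t', r'', .seq h1 h3, by omega, h5⟩

lemma runs_instr {r₁ : ℕ → ℕ} (h : Exec w mem p r 1 r₁) (h' : Runs w mem (seqs ps) r₁ T Q) :
    Runs w mem (seqs (p :: ps)) r (T + 1) Q :=
  runs_cons ⟨1, r₁, h, le_rfl, h'⟩

lemma runs_const (hv : v < 2 ^ w) (h : Runs w mem (seqs ps) (Function.update r d v) T Q) :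
    Runs w mem (seqs (.const d v :: ps)) r (T + 1) Q :=
  runs_instr (.const d v r) (by rwa [Nat.mod_eq_of_lt hv])

lemma runs_copy (hv : r a = v) (h : Runs w mem (seqs ps) (Function.update r d v) T Q) :
    Runs w mem (seqs (.copy d a :: ps)) r (T + 1) Q :=
  runs_instr (.copy d a r) (by rwa [hv])

lemma runs_load {u : ℕ} (hu : r a = u) (hv : mem.getD u 0 = v)
    (h : Runs w mem (seqs ps) (Function.update r d v) T Q) :
    Runs w mem (seqs (.load d a :: ps)) r (T + 1) Q :=
  runs_instr (.load d a r) (by rwa [hu, hv])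

lemma runs_op {o : BinOp} (hv : o.eval w (r a) (r b) = v)
    (h : Runs w mem (seqs ps) (Function.update r d v) T Q) :
    Runs w mem (seqs (.op o d a b :: ps)) r (T + 1) Q :=
  runs_instr (.op o d a b r) (by rwa [hv])

lemma runs_add (hv : r a + r b = v) (hw : v < 2 ^ w)
    (h : Runs w mem (seqs ps) (Function.update r d v) T Q) :
    Runs w mem (seqs (.op .add d a b :: ps)) r (T + 1) Q :=
  runs_op (by rw [BinOp.eval, hv, Nat.mod_eq_of_lt hw]) h

lemma runs_mul (hv : r a * r b = v) (hw : v < 2 ^ w)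
    (h : Runs w mem (seqs ps) (Function.update r d v) T Q) :
    Runs w mem (seqs (.op .mul d a b :: ps)) r (T + 1) Q :=
  runs_op (by rw [BinOp.eval, hv, Nat.mod_eq_of_lt hw]) h

lemma runs_div (hv : r a / r b = v) (hw : r a < 2 ^ w)
    (h : Runs w mem (seqs ps) (Function.update r d v) T Q) :
    Runs w mem (seqs (.op .div d a b :: ps)) r (T + 1) Q :=
  runs_op (by
    rw [BinOp.eval, hv, Nat.mod_eq_of_lt (hv ▸ lt_of_le_of_lt (Nat.div_le_self _ _) hw)]) h

lemma runs_shr (hv : r a / 2 ^ r b = v) (hw : r a < 2 ^ w)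
    (h : Runs w mem (seqs ps) (Function.update r d v) T Q) :
    Runs w mem (seqs (.op .shr d a b :: ps)) r (T + 1) Q :=
  runs_op (by
    rw [BinOp.eval, Nat.shiftRight_eq_div_pow, hv,
      Nat.mod_eq_of_lt (hv ▸ lt_of_le_of_lt (Nat.div_le_self _ _) hw)]) h

lemma runs_sub (hv : r a - r b = v) (hle : r b ≤ r a) (hw : r a < 2 ^ w)
    (h : Runs w mem (seqs ps) (Function.update r d v) T Q) :
    Runs w mem (seqs (.op .sub d a b :: ps)) r (T + 1) Q :=
  runs_op (by
    rw [BinOp.eval, Nat.mod_eq_of_lt (lt_of_le_of_lt hle hw),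
      show r a + (2 ^ w - r b) = (r a - r b) + 2 ^ w by omega, Nat.add_mod_right,
      Nat.mod_eq_of_lt (lt_of_le_of_lt (Nat.sub_le _ _) hw), hv]) h

lemma runs_ifLt (h₁ : r a < r b → Runs w mem p r T Q) (h₂ : r b ≤ r a → Runs w mem q r T Q) :
    Runs w mem (.ifLt a b p q) r (T + 1) Q := by
  by_cases h : r a < r b
  · obtain ⟨t, r', e, ht, hQ⟩ := h₁ h
    exact ⟨t + 1, r', .ifTrue h e, by omega, hQ⟩
  · obtain ⟨t, r', e, ht, hQ⟩ := h₂ (not_lt.1 h)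
    exact ⟨t + 1, r', .ifFalse h e, by omega, hQ⟩

/-- A loop rule in which the invariant `I` is indexed by the number of remaining rounds. -/
lemma runs_whileLt (I : ℕ → (ℕ → ℕ) → Prop) (h0 : ∀ r, I 0 r → r b ≤ r a)
    (hs : ∀ n r, I (n + 1) r → r a < r b ∧ Runs w mem p r T (I n)) (n : ℕ) (hr : I n r) :
    Runs w mem (.whileLt a b p) r (n * (T + 1) + 1) (I 0) := by
  induction n generalizing r with
  | zero => exact ⟨1, r, .whileFalse (not_lt.2 (h0 r hr)), by omega, hr⟩
  | succ n ih =>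
    obtain ⟨hlt, t, r', e, ht, hI⟩ := hs n r hr
    obtain ⟨t', r'', e', ht', hI'⟩ := ih hI
    refine ⟨t + t' + 1, r'', .whileTrue hlt e e', ?_, hI'⟩
    rw [Nat.succ_mul]
    omega

/-- `d := a mod b`, with `t` as a scratch register. -/
def modProg (d a b t : ℕ) : Prog :=
  seqs [.op .div t a b, .op .mul t t b, .op .sub d a t]

lemma runs_mod {t : ℕ} (hv : r a % r b = v) (hw : r a < 2 ^ w) (hat : a ≠ t) (hbt : b ≠ t)
    (h : Runs w mem (seqs ps) (Function.update (Function.update r t (r a / r b * r b)) d v) T Q) :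
    Runs w mem (seqs (modProg d a b t :: ps)) r (T + 3) Q := by
  have hle : r a / r b * r b ≤ r a := Nat.div_mul_le_self _ _
  refine runs_cons ?_
  refine runs_div rfl hw (runs_mul (v := r a / r b * r b) (by simp [hbt]) (by omega)
    (runs_sub rfl (by simp [hat]; exact hle) (by simp [hat]; exact hw) (runs_nil ?_)))
  convert h using 1
  funext k
  rcases eq_or_ne k d with rfl | hd
  · simp [hat, ← hv]
    have := Nat.div_add_mod' (r a) (r b)
    omega
  · simp [hd]

/-! ### The query program -/

/-- The row of the hash table that the hash function stored in `mem` assigns to the key `x`.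
The parameters of bucket `i` (multiplier, offset and size) have the addresses `16 * i`, `16 * i + 1`
and `16 * i + 2`. -/
def hashRow (mem : List ℕ) (p a s x : ℕ) : ℕ :=
  mem.getD (16 * (a * x % p % s) + 1) 0 +
    mem.getD (16 * (a * x % p % s)) 0 * x % p % mem.getD (16 * (a * x % p % s) + 2) 0

/-- Computes into register 15 the address `16 * hashRow mem p a s x` for the key `x` in register 14,
with the parameters `p`, `a`, `s`, `16`, `1` in registers 5 to 9. -/
def hashProg : Prog := seqs
  [.op .mul 15 6 14, modProg 15 15 5 16, modProg 15 15 7 16, .op .mul 15 15 8, .load 17 15,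
    .op .add 15 15 9, .load 18 15, .op .add 15 15 9, .load 19 15, .op .mul 15 17 14,
    modProg 15 15 5 16, modProg 15 15 19 16, .op .add 15 15 18, .op .mul 15 15 8]

lemma runs_hashProg {p a s x : ℕ} (h5 : r 5 = p) (h6 : r 6 = a) (h7 : r 7 = s) (h8 : r 8 = 16)
    (h9 : r 9 = 1) (h14 : r 14 = x) (hap : a < p) (hx : x < p)
    (hpp : p * p ≤ 2 ^ w) (hsw : 16 * s ≤ 2 ^ w) (hs : 0 < s)
    (hA : ∀ i < s, mem.getD (16 * i) 0 < p)
    (hrow : 16 * hashRow mem p a s x < 2 ^ w) :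
    Runs w mem hashProg r 22 fun r' => r' 15 = 16 * hashRow mem p a s x ∧
      ∀ k, k < 15 → r' k = r k := by
  have hi : a * x % p % s < s := Nat.mod_lt _ hs
  have hA' := hA _ hi
  unfold hashRow at hrow ⊢
  generalize hidef : a * x % p % s = i at *
  generalize hc : mem.getD (16 * i) 0 = c at *
  generalize ho : mem.getD (16 * i + 1) 0 = o at *
  generalize hz : mem.getD (16 * i + 2) 0 = z at *
  have hax : a * x < 2 ^ w := lt_of_lt_of_le (Nat.mul_lt_mul'' hap hx) hpp
  have hcx : c * x < 2 ^ w := lt_of_lt_of_le (Nat.mul_lt_mul'' hA' hx) hpp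
  have hm1 : a * x % p ≤ a * x := Nat.mod_le _ _
  have hm2 : c * x % p ≤ c * x := Nat.mod_le _ _
  refine runs_mul (v := a * x) (by simp [*]) hax ?_
  refine runs_mod (v := a * x % p) (by simp [*]) (by simp [*]) (by decide) (by decide) ?_
  refine runs_mod (v := i) (by simp [*]) (by simp; omega) (by decide) (by decide) ?_
  refine runs_mul (v := 16 * i) (by simp [*, mul_comm]) (by omega) ?_
  refine runs_load (u := 16 * i) (by simp [*]) hc ?_
  refine runs_add (v := 16 * i + 1) (by simp [*]) (by omega) ?_
  refine runs_load (u := 16 * i + 1) (by simp [*]) ho ?_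
  refine runs_add (v := 16 * i + 2) (by simp [*]) (by omega) ?_
  refine runs_load (u := 16 * i + 2) (by simp [*]) hz ?_
  refine runs_mul (v := c * x) (by simp [*]) hcx ?_
  refine runs_mod (v := c * x % p) (by simp [*]) (by simp [*]) (by decide) (by decide) ?_
  refine runs_mod (v := c * x % p % z) (by simp [*]) (by simp; omega) (by decide) (by decide) ?_
  refine runs_add (v := o + c * x % p % z) (by simp [add_comm]) (by omega) ?_
  refine runs_mul (v := 16 * (o + c * x % p % z)) (by simp [*, mul_comm]) hrow ?_
  refine runs_nil ⟨by simp, fun k hk => ?_⟩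
  simp [show k ≠ 15 by omega, show k ≠ 16 by omega, show k ≠ 17 by omega,
    show k ≠ 18 by omega, show k ≠ 19 by omega]

/-- The memory `mem` encodes the trie of `S` with `L` levels of `κ` bits. The words 8 to 14 hold the
parameters of the query. The word `16 * i + k` belongs to row `i` of a table; for `k = 0, 1, 2` it
describes bucket `i` of the hash function, and for `k = 3, …, 6` it belongs to a record: the level
and the key of a branching prefix, and the codes of the two candidates for the predecessor. The
dictionary key of the prefix `pfx κ f y` of level `f` is `f * m + pfx κ f y`. -/
structure IsEncoding (w κ m L : ℕ) (S : Finset ℕ) (mem : List ℕ) (p a s : ℕ) : Prop where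
  header_shift : mem.getD 8 0 = κ
  header_univ : mem.getD 9 0 = m
  header_prime : mem.getD 10 0 = p
  header_mult : mem.getD 11 0 = a
  header_size : mem.getD 12 0 = s
  header_top : mem.getD 13 0 = L + 1
  header_pow : mem.getD 14 0 = 2 ^ Nat.log 2 L
  two_le : 2 ≤ m
  word_lt : 32 * (m + κ + L + κ * (L + 1)) < 2 ^ w
  key_le : (L + 1) * m ≤ p
  mult_lt : a < p
  prime_le : p * p ≤ 2 ^ w
  size_pos : 0 < s
  size_le : 16 * s ≤ 2 ^ w
  bucket_lt : ∀ i < s, mem.getD (16 * i) 0 < p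
  row_lt : ∀ x < p, 16 * hashRow mem p a s x + 6 < 2 ^ w
  /-- Every record, the one of an absent key too, is void or describes a branching prefix. -/
  record_sound : ∀ x < p,
    (mem.getD (16 * hashRow mem p a s x + 3) 0 = L + 1 ∧
      mem.getD (16 * hashRow mem p a s x + 4) 0 = 0) ∨
    ∃ f, Handle κ S L (mem.getD (16 * hashRow mem p a s x + 3) 0)
      (mem.getD (16 * hashRow mem p a s x + 4) 0) f
  handle_stored : ∀ f ≤ L, ∀ y < m, (∃ j b, Handle κ S L j b f ∧ pfx κ f b = pfx κ f y) →
    Handle κ S L (mem.getD (16 * hashRow mem p a s (f * m + pfx κ f y) + 3) 0)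
      (mem.getD (16 * hashRow mem p a s (f * m + pfx κ f y) + 4) 0) f ∧
    pfx κ f (mem.getD (16 * hashRow mem p a s (f * m + pfx κ f y) + 4) 0) = pfx κ f y
  code_stored : ∀ f ≤ L, ∀ y < m, (f = L ∨ Branch κ S (f + 1) y) →
    mem.getD (16 * hashRow mem p a s (f * m + pfx κ f y) + 5) 0 =
      (S.filter fun x => pfx κ f x < pfx κ f y).sup (· + 1) ∧
    mem.getD (16 * hashRow mem p a s (f * m + pfx κ f y) + 6) 0 =
      (S.filter fun x => pfx κ f x ≤ pfx κ f y).sup (· + 1)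
  keys_lt : ∀ x ∈ S, x < m

/-- Computes into register 15 the address of the row of the prefix of `y` of the level that is in
register 13. -/
def lookupProg : Prog := seqs
  [.op .mul 14 2 13, .op .shr 15 0 14, .op .mul 14 13 3, .op .add 14 14 15, hashProg]

/-- The registers that keep their contents throughout the search: the key and the parameters, and a
register holding `0`. -/
structure HasParams (κ m p a s y : ℕ) (r : ℕ → ℕ) : Prop where
  key : r 0 = y
  zero : r 1 = 0
  shift : r 2 = κ
  univ : r 3 = m
  prime : r 5 = p
  mult : r 6 = a
  size : r 7 = s
  stride : r 8 = 16
  one : r 9 = 1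

lemma HasParams.congr {κ m p a s y : ℕ} {r r' : ℕ → ℕ} (h : HasParams κ m p a s y r)
    (e : ∀ k < 10, r' k = r k) : HasParams κ m p a s y r' := by
  obtain ⟨h0, h1, h2, h3, h5, h6, h7, h8, h9⟩ := h
  constructor <;> rw [e _ (by norm_num)] <;> assumption

lemma runs_lookupProg {κ m L p a s y f : ℕ} {S : Finset ℕ} (E : IsEncoding w κ m L S mem p a s)
    (hr : HasParams κ m p a s y r) (hy : y < m) (hf : f ≤ L) (h13 : r 13 = f) :
    Runs w mem lookupProg r 26 fun r' =>
      r' 15 = 16 * hashRow mem p a s (f * m + pfx κ f y) ∧ ∀ k, k < 14 → r' k = r k := by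
  obtain ⟨h0, h1, h2, h3, h5, h6, h7, h8, h9⟩ := hr
  have hw := E.word_lt
  have hp2 : p ≤ p * p := Nat.le_mul_self p
  have hpw := E.prime_le
  have hkf : κ * f ≤ κ * (L + 1) := Nat.mul_le_mul_left _ (by omega)
  have hfm : (f + 1) * m ≤ (L + 1) * m := Nat.mul_le_mul_right _ (by omega)
  have hy' : pfx κ f y ≤ y := pfx_le_self _ _ _
  have hkey := E.key_le
  rw [Nat.succ_mul] at hfm
  refine runs_mul (v := κ * f) (by simp [*]) (by omega) ?_
  refine runs_shr (v := pfx κ f y) (by simp [*, pfx]) (by simp [*]; omega) ?_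
  refine runs_mul (v := f * m) (by simp [*]) (by omega) ?_
  refine runs_add (v := f * m + pfx κ f y) (by simp [*]) (by omega) ?_
  refine runs_cons (T' := 0) ((runs_hashProg (p := p) (a := a) (s := s) (x := f * m + pfx κ f y)
    (by simp [*]) (by simp [*]) (by simp [*]) (by simp [*]) (by simp [*]) (by simp)
    E.mult_lt (by omega) hpw E.size_le E.size_pos E.bucket_lt ?_).mono le_rfl ?_)
  · have := E.row_lt (f * m + pfx κ f y) (by omega)
    omega
  · rintro r' ⟨h15, hfr⟩
    refine runs_nil ⟨h15, fun k hk => ?_⟩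
    rw [hfr k (by omega)]
    simp [show k ≠ 15 by omega, show k ≠ 14 by omega]

/-- Probes the level `f` in register 13: if the record describes a branching prefix of `y` on a
level `j ≤ f`, then the upper end `A` of the interval (register 10) becomes `j`, and otherwise the
lower end `B` (register 11) becomes `f + 1`. -/
def probeProg : Prog := seqs
  [lookupProg, .const 16 3, .op .add 15 15 16, .load 16 15, .op .add 15 15 9, .load 17 15,
    .ifLt 13 16 (seqs [.op .add 11 13 9]) (seqs
      [.op .mul 14 2 16, .op .shr 17 17 14, .op .shr 18 0 14,
        .ifLt 17 18 (seqs [.op .add 11 13 9])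
          (seqs [.ifLt 18 17 (seqs [.op .add 11 13 9]) (seqs [.copy 10 16])])])]

lemma runs_probeProg {κ m L p a s y f A B e : ℕ} {S : Finset ℕ}
    (E : IsEncoding w κ m L S mem p a s)
    (hr : HasParams κ m p a s y r) (hy : y < m) (h13 : r 13 = f) (h10 : r 10 = A) (h11 : r 11 = B)
    (hA : A = L + 1 ∨ Branch κ S A y) (hA1 : 1 ≤ A) (hAL : A ≤ L + 1)
    (hB : ∀ i < B, ¬ Branch κ S i y) (hfA : f < A)
    (hdvd : 2 ^ e ∣ f) (hmul : ∀ g, B ≤ g → g < A → g ≠ f → ¬ 2 ^ e ∣ g) :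
    Runs w mem probeProg r 50 fun r' => HasParams κ m p a s y r' ∧ r' 12 = r 12 ∧
      (r' 10 = A ∧ r' 11 = f + 1 ∧ (∀ i < f + 1, ¬ Branch κ S i y) ∨
        r' 11 = B ∧ 1 ≤ r' 10 ∧ r' 10 ≤ f ∧ Branch κ S (r' 10) y) := by
  have hfL : f ≤ L := by omega
  have hw := E.word_lt
  refine runs_cons (T' := 24) ((runs_lookupProg E hr hy hfL h13).mono le_rfl ?_)
  rintro r₁ ⟨h15, hfr⟩
  have hr₁ : HasParams κ m p a s y r₁ := hr.congr fun k hk => hfr k (by omega)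
  obtain ⟨g0, g1, g2, g3, g5, g6, g7, g8, g9⟩ := hr₁
  have g10 : r₁ 10 = A := by rw [hfr _ (by norm_num), h10]
  have g11 : r₁ 11 = B := by rw [hfr _ (by norm_num), h11]
  have g12 : r₁ 12 = r 12 := hfr _ (by norm_num)
  have g13 : r₁ 13 = f := by rw [hfr _ (by norm_num), h13]
  have hkf : κ * f ≤ κ * (L + 1) := Nat.mul_le_mul_left _ (by omega)
  have hfm : (f + 1) * m ≤ (L + 1) * m := Nat.mul_le_mul_right _ (by omega)
  have hy' : pfx κ f y ≤ y := pfx_le_self _ _ _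
  have hkey := E.key_le
  rw [Nat.succ_mul] at hfm
  have hsound := E.record_sound (f * m + pfx κ f y) (by omega)
  have hstored := E.handle_stored f hfL y hy
  have hrow := E.row_lt (f * m + pfx κ f y) (by omega)
  clear hfr h13 h10 h11 hr
  generalize hashRow mem p a s (f * m + pfx κ f y) = R at *
  generalize hj : mem.getD (16 * R + 3) 0 = j at *
  generalize hb : mem.getD (16 * R + 4) 0 = b at *
  have hjL : j ≤ L + 1 := by
    rcases hsound with h | ⟨f', h⟩
    · exact h.1.le
    · have := h.2.1; have := h.2.2.1; omega
  have hbm : b < m := by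
    rcases hsound with h | ⟨f', h⟩
    · have := E.two_le; omega
    · exact E.keys_lt _ h.1.1
  have hkj : κ * j ≤ κ * (L + 1) := Nat.mul_le_mul_left _ hjL
  refine runs_const (by omega) ?_
  refine runs_add (v := 16 * R + 3) (by simp [*]) (by omega) ?_
  refine runs_load (u := 16 * R + 3) (by simp [*]) hj ?_
  refine runs_add (v := 16 * R + 4) (by simp [*]) (by omega) ?_
  refine runs_load (u := 16 * R + 4) (by simp [*]) hb ?_
  refine runs_cons (T := 19) (T' := 0) ?_
  have hraise : ∀ r₂ : ℕ → ℕ, (∀ k < 14, r₂ k = r₁ k) → (∀ i < f + 1, ¬ Branch κ S i y) →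
      Runs w mem (seqs [.op .add 11 13 9]) r₂ 1 fun r' => Runs w mem (seqs []) r' 0 fun r' =>
      HasParams κ m p a s y r' ∧ r' 12 = r 12 ∧
      (r' 10 = A ∧ r' 11 = f + 1 ∧ (∀ i < f + 1, ¬ Branch κ S i y) ∨
        r' 11 = B ∧ 1 ≤ r' 10 ∧ r' 10 ≤ f ∧ Branch κ S (r' 10) y) := by
    intro r₂ h₂ hno
    refine runs_add (v := f + 1) (by simp [*]) (by omega) (runs_nil (runs_nil ⟨?_, ?_, ?_⟩))
    · constructor <;> simp [*]
    · simp [*]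
    · left
      exact ⟨by simp [*], by simp, hno⟩
  refine runs_ifLt (T := 18) (fun hlt => ?_) (fun hle => ?_)
  · simp [*] at hlt
    refine (hraise _ ?_ ?_).mono (by omega) fun _ h => h
    · intro k hk
      simp [show k ≠ 15 by omega, show k ≠ 16 by omega,
        show k ≠ 17 by omega]
    · intro i hi hbr
      have := (hstored (exists_handle hA hAL hB hfA hdvd hmul ⟨i, by omega, hbr⟩)).1.2.1
      omega
  · simp [*] at hle
    have hne : pfx κ j b ≠ pfx κ j y → ∀ i < f + 1, ¬ Branch κ S i y := by
      intro hne i hi hbr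
      have h := hstored (exists_handle hA hAL hB hfA hdvd hmul ⟨i, by omega, hbr⟩)
      exact hne (h.1.pfx_eq h.2 ⟨i, by omega, hbr⟩)
    refine runs_mul (v := κ * j) (by simp [*]) (by omega) ?_
    refine runs_shr (v := pfx κ j b) (by simp [*, pfx]) (by simp [*]; omega) ?_
    refine runs_shr (v := pfx κ j y) (by simp [*, pfx]) (by simp [*]; omega) ?_
    refine runs_cons (T := 15) (T' := 0) (runs_ifLt (T := 14) (fun hlt => ?_) (fun hge => ?_))
    · simp at hlt
      refine (hraise _ ?_ (hne hlt.ne)).mono (by omega) fun _ h => runs_nil h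
      intro k hk
      simp [show k ≠ 14 by omega, show k ≠ 15 by omega,
        show k ≠ 16 by omega, show k ≠ 17 by omega, show k ≠ 18 by omega]
    simp at hge
    refine runs_cons (T := 14) (T' := 0) (runs_ifLt (T := 13) (fun hlt => ?_) (fun hge' => ?_))
    · simp at hlt
      refine (hraise _ ?_ (hne hlt.ne')).mono (by omega) fun _ h => runs_nil (runs_nil h)
      intro k hk
      simp [show k ≠ 14 by omega, show k ≠ 15 by omega,
        show k ≠ 16 by omega, show k ≠ 17 by omega, show k ≠ 18 by omega]
    simp at hge'
    have hjy : Branch κ S j y := by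
      rcases hsound with h | ⟨f', h⟩
      · omega
      · exact h.1.branch.congr (le_antisymm hge' hge)
    refine Runs.mono (T := 1) (runs_copy (v := j) (by simp) (runs_nil
      (runs_nil (runs_nil (runs_nil ⟨?_, ?_, ?_⟩))))) (by omega) fun _ h => h
    · constructor <;> simp [*]
    · simp [*]
    · right
      refine ⟨by simp [*], ?_, ?_, ?_⟩
      · simp; exact hjy.1
      · simp; exact hle
      · simp; exact hjy

/-- One round of the search: probes the first multiple of `P` (register 12) from `B` on, if it lies
below `A`, and halves `P`. -/
def stepProg : Prog := seqs
  [.op .add 13 11 12, .op .sub 13 13 9, .op .div 13 13 12, .op .mul 13 13 12,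
    .ifLt 13 10 probeProg (seqs []), .op .shr 12 12 9]

/-- The invariant of the search with `n` rounds remaining. Here `2 ^ n / 2` is the power of two of
the next round, or `0` if there is none, and no multiple of `2 ^ n` is left in `[B, A)`. -/
structure SearchInv (κ m L p a s y : ℕ) (S : Finset ℕ) (n : ℕ) (r : ℕ → ℕ) : Prop where
  params : HasParams κ m p a s y r
  step_eq : r 12 = 2 ^ n / 2
  step_le : r 12 ≤ L + 1
  upper : r 10 = L + 1 ∨ Branch κ S (r 10) y
  one_le : 1 ≤ r 10
  upper_le : r 10 ≤ L + 1
  lower_pos : 1 ≤ r 11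
  lower_le : r 11 ≤ L + 1
  lower : ∀ i < r 11, ¬ Branch κ S i y
  sparse : ∀ g, r 11 ≤ g → g < r 10 → ¬ 2 ^ n ∣ g

/-- Rounding `B` up to a multiple of `P`. -/
lemma ceil_mul_facts {B P : ℕ} (hP : 0 < P) :
    B ≤ (B + P - 1) / P * P ∧ (B + P - 1) / P * P < B + P ∧
      ∀ g, B ≤ g → P ∣ g → (B + P - 1) / P * P ≤ g := by
  have h1 := Nat.div_add_mod' (B + P - 1) P
  have h2 := Nat.mod_lt (B + P - 1) hP
  refine ⟨by omega, by omega, fun g hg => ?_⟩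
  rintro ⟨c, rfl⟩
  rw [mul_comm P c]
  refine Nat.mul_le_mul_right _ ?_
  by_contra! hlt
  have := Nat.mul_le_mul_right P (Nat.succ_le_of_lt hlt)
  rw [Nat.succ_mul, mul_comm c P] at this
  omega

/-- Of two consecutive multiples of `2 ^ n`, one is a multiple of `2 ^ (n + 1)`. So an interval
without multiples of `2 ^ (n + 1)` has no multiple of `2 ^ n` but the first one. -/
lemma sparse_unique {A B n f : ℕ} (hsp : ∀ g, B ≤ g → g < A → ¬ 2 ^ (n + 1) ∣ g) (hBf : B ≤ f)
    (hf : 2 ^ n ∣ f) (hmin : ∀ g, B ≤ g → 2 ^ n ∣ g → f ≤ g) {g : ℕ} (hBg : B ≤ g) (hgA : g < A)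
    (hgf : g ≠ f) : ¬ 2 ^ n ∣ g := by
  intro hg
  have hlt : f < g := lt_of_le_of_ne (hmin g hBg hg) hgf.symm
  have hle : f + 2 ^ n ≤ g := by
    have := Nat.le_of_dvd (by omega) (Nat.dvd_sub hg hf)
    omega
  obtain ⟨c, rfl⟩ := hf
  rcases Nat.even_or_odd' c with ⟨k, rfl | rfl⟩
  · exact hsp _ hBf (by omega) ⟨k, by ring⟩
  · exact hsp _ (by omega) (lt_of_le_of_lt hle hgA) ⟨k + 1, by ring⟩

lemma runs_stepProg {κ m L p a s y n : ℕ} {S : Finset ℕ} (E : IsEncoding w κ m L S mem p a s)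
    (hy : y < m) (h : SearchInv κ m L p a s y S (n + 1) r) :
    Runs w mem stepProg r 60 (SearchInv κ m L p a s y S n) := by
  obtain ⟨hr, hP, hPL, hA, hA1, hAL, hB1, hBL, hB, hsp⟩ := h
  have hw := E.word_lt
  have hm := E.two_le
  have hP' : r 12 = 2 ^ n := by rw [hP, pow_succ]; simp
  have hPpos : 0 < r 12 := by rw [hP']; positivity
  obtain ⟨hf1, hf2, hf3⟩ := ceil_mul_facts (B := r 11) hPpos
  have hdvd : 2 ^ n ∣ (r 11 + r 12 - 1) / r 12 * r 12 := hP' ▸ Dvd.intro_left _ rfl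
  have hmul : ∀ g, r 11 ≤ g → g < r 10 → g ≠ (r 11 + r 12 - 1) / r 12 * r 12 → ¬ 2 ^ n ∣ g :=
    fun g h1 h2 h3 => sparse_unique hsp hf1 hdvd (hP' ▸ hf3) h1 h2 h3
  have h9 := hr.one
  refine Runs.mono (T := 56) ?_ (by norm_num) (fun _ h => h)
  refine runs_add (v := r 11 + r 12) rfl (by omega) ?_
  refine runs_sub (v := r 11 + r 12 - 1) (by simp [*]) (by simp [*]; omega)
    (by simp; omega) ?_
  refine runs_div (v := (r 11 + r 12 - 1) / r 12) (by simp) (by simp; omega) ?_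
  refine runs_mul (v := (r 11 + r 12 - 1) / r 12 * r 12) (by simp) (by omega) ?_
  generalize (r 11 + r 12 - 1) / r 12 * r 12 = f at *
  generalize hr₁ : Function.update (β := fun _ => ℕ) _ 13 f = r₁
  have hr₁k : ∀ k < 13, r₁ k = r k := by
    intro k hk
    subst hr₁
    simp [show k ≠ 13 by omega]
  have h13 : r₁ 13 = f := by subst hr₁; simp
  clear hr₁
  have g10 := hr₁k 10 (by norm_num)
  have g11 := hr₁k 11 (by norm_num)
  have g12 := hr₁k 12 (by norm_num)
  have hrp : HasParams κ m p a s y r₁ := hr.congr fun k hk => hr₁k k (by omega)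
  have hhalf : ∀ r₂ : ℕ → ℕ, HasParams κ m p a s y r₂ → r₂ 12 = r 12 →
      (r₂ 10 = L + 1 ∨ Branch κ S (r₂ 10) y) → 1 ≤ r₂ 10 → r₂ 10 ≤ L + 1 → 1 ≤ r₂ 11 →
      r₂ 11 ≤ L + 1 → (∀ i < r₂ 11, ¬ Branch κ S i y) →
      (∀ g, r₂ 11 ≤ g → g < r₂ 10 → ¬ 2 ^ n ∣ g) →
      Runs w mem (seqs [.op .shr 12 12 9]) r₂ 1 (SearchInv κ m L p a s y S n) := by
    intro r₂ k0 k1 k2 k3 k4 k5 k6 k7 k8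
    have k9 := k0.one
    refine runs_shr (v := 2 ^ n / 2) (by simp [k1, k9, hP']) (by omega) (runs_nil ?_)
    refine ⟨k0.congr fun k hk => ?_, by simp, ?_, by simpa using k2, by simpa using k3,
      by simpa using k4, by simpa using k5, by simpa using k6, by simpa using k7,
      by simpa using k8⟩
    · simp [show k ≠ 12 by omega]
    · simp
      omega
  refine runs_cons (T' := 1) (runs_ifLt (T := 50) (fun hlt => ?_) (fun hge => ?_))
  · rw [h13, g10] at hlt
    refine (runs_probeProg (e := n) E hrp hy h13 g10 g11 hA hA1 hAL hB hlt hdvd hmul).mono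
      le_rfl ?_
    rintro r₂ ⟨q1, q2, ⟨q3, q4, q5⟩ | ⟨q3, q4, q5, q6⟩⟩
    · refine hhalf r₂ q1 (by omega) (by rwa [q3]) (by omega) (by omega) (by omega) (by omega)
        (by rwa [q4]) ?_
      intro g h1 h2
      exact hmul g (by omega) (by omega) (by omega)
    · refine hhalf r₂ q1 (by omega) (Or.inr q6) (by omega) (by omega) (by omega) (by omega)
        (by rwa [q3]) ?_
      intro g h1 h2
      exact hmul g (by omega) (by omega) (by omega)
  · rw [h13, g10] at hge
    refine Runs.mono (T := 0) (runs_nil ?_) (by norm_num) fun _ h => h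
    refine hhalf r₁ hrp g12 (by rwa [g10]) (by omega) (by omega) (by omega) (by omega)
        (by rwa [g11]) ?_
    intro g h1 h2
    exact hmul g (by omega) (by omega) (by omega)

/-- Loads the parameters and starts the search with the interval `[1, L + 1)`. -/
def initProg : Prog := seqs
  [.const 8 16, .const 9 1, .const 13 8, .load 2 13, .op .add 13 13 9, .load 3 13,
    .op .add 13 13 9, .load 5 13, .op .add 13 13 9, .load 6 13, .op .add 13 13 9, .load 7 13,
    .op .add 13 13 9, .load 10 13, .op .add 13 13 9, .load 12 13, .const 11 1]

lemma runs_initProg {κ m L p a s y : ℕ} {S : Finset ℕ} (E : IsEncoding w κ m L S mem p a s) :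
    Runs w mem initProg (input y) 17 (SearchInv κ m L p a s y S (Nat.log 2 L + 1)) := by
  have hw := E.word_lt
  have hm := E.two_le
  have hlog : 2 ^ Nat.log 2 L ≤ L + 1 := by
    rcases Nat.eq_zero_or_pos L with rfl | hL
    · simp
    · exact (Nat.pow_log_le_self 2 hL.ne').trans (Nat.le_succ L)
  refine runs_const (by omega) (runs_const (by omega) (runs_const (by omega) ?_))
  refine runs_load (u := 8) (by simp) E.header_shift ?_
  refine runs_add (v := 9) (by simp) (by omega) ?_
  refine runs_load (u := 9) (by simp) E.header_univ ?_
  refine runs_add (v := 10) (by simp) (by omega) ?_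
  refine runs_load (u := 10) (by simp) E.header_prime ?_
  refine runs_add (v := 11) (by simp) (by omega) ?_
  refine runs_load (u := 11) (by simp) E.header_mult ?_
  refine runs_add (v := 12) (by simp) (by omega) ?_
  refine runs_load (u := 12) (by simp) E.header_size ?_
  refine runs_add (v := 13) (by simp) (by omega) ?_
  refine runs_load (u := 13) (by simp) E.header_top ?_
  refine runs_add (v := 14) (by simp) (by omega) ?_
  refine runs_load (u := 14) (by simp) E.header_pow ?_
  refine runs_const (by omega) (runs_nil ?_)
  refine ⟨by constructor <;> simp [input], ?_, ?_, ?_, ?_, ?_, ?_, ?_, ?_, ?_⟩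
  · simp [pow_succ]
  · simpa using hlog
  · simp
  · simp
  · simp
  · simp
  · simp
  · intro i hi hbr
    have := hbr.1
    simp at hi
    omega
  · intro g h1 h2
    simp at h1 h2
    intro h
    have h3 := Nat.le_of_dvd (by omega) h
    have h4 := Nat.lt_pow_succ_log_self (b := 2) (by norm_num) L
    rw [← Nat.succ_eq_add_one] at h3
    omega

/-- Looks up the two candidates for the predecessor on the level below the final `A` and selects the
right one. -/
def answerProg : Prog := seqs
  [.op .sub 13 10 9, lookupProg, .const 16 5, .op .add 15 15 16, .load 16 15, .op .add 15 15 9,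
    .load 17 15, .op .add 14 0 9, .ifLt 14 17 (seqs [.copy 1 16]) (seqs [.copy 1 17]),
    .op .sub 0 1 9]

lemma runs_answerProg {κ m L p a s y : ℕ} {S : Finset ℕ} (E : IsEncoding w κ m L S mem p a s)
    (hy : y < m) (h : SearchInv κ m L p a s y S 0 r) :
    Runs w mem answerProg r 40 fun r' => output r' = pred S y := by
  obtain ⟨hr, -, -, hA, hA1, hAL, -, -, hB, hsp⟩ := h
  have hw := E.word_lt
  have hAB : ∀ i < r 10, ¬ Branch κ S i y := by
    intro i hi
    refine hB i ?_
    by_contra! hle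
    exact hsp i hle hi (by simp)
  have hm := E.two_le
  have h9 := hr.one
  have hcode := predCode_eq_of_no_branch hA1 hAB
  rw [pred_eq_predCode, hcode]
  have hst := E.code_stored (r 10 - 1) (by omega) y hy
    (by rw [Nat.sub_add_cancel hA1]; rcases hA with h | h
        · left; omega
        · exact Or.inr h)
  have hcb : ∀ q : ℕ → Prop, ∀ _ : DecidablePred q, (S.filter q).sup (· + 1) ≤ m := fun q _ =>
    Finset.sup_le fun x hx => E.keys_lt x (Finset.mem_filter.1 hx).1
  refine Runs.mono (T := 36) ?_ (by norm_num) (fun _ h => h)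
  refine runs_sub (v := r 10 - 1) (by simp [*]) (by simp [*]) (by omega) ?_
  refine runs_cons (T' := 9) ((runs_lookupProg (f := r 10 - 1) E (hr.congr fun k hk => by
    simp [show k ≠ 13 by omega]) hy (by omega) (by simp)).mono le_rfl ?_)
  rintro r₁ ⟨h15, hfr⟩
  have g0 : r₁ 0 = y := by rw [hfr _ (by norm_num)]; simpa using hr.key
  have g9 : r₁ 9 = 1 := by rw [hfr _ (by norm_num)]; simpa using h9
  clear hfr
  have hfm : (r 10 - 1 + 1) * m ≤ (L + 1) * m := Nat.mul_le_mul_right _ (by omega)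
  have hy' : pfx κ (r 10 - 1) y ≤ y := pfx_le_self _ _ _
  have hkey := E.key_le
  rw [Nat.succ_mul] at hfm
  have hrow := E.row_lt ((r 10 - 1) * m + pfx κ (r 10 - 1) y) (by omega)
  have hlo := hcb (fun x => pfx κ (r 10 - 1) x < pfx κ (r 10 - 1) y) inferInstance
  have hhi := hcb (fun x => pfx κ (r 10 - 1) x ≤ pfx κ (r 10 - 1) y) inferInstance
  generalize (S.filter fun x => pfx κ (r 10 - 1) x < pfx κ (r 10 - 1) y).sup (· + 1) = lo at *
  generalize (S.filter fun x => pfx κ (r 10 - 1) x ≤ pfx κ (r 10 - 1) y).sup (· + 1) = hi at *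
  generalize hashRow mem p a s ((r 10 - 1) * m + pfx κ (r 10 - 1) y) = R at *
  refine runs_const (by omega) ?_
  refine runs_add (v := 16 * R + 5) (by simp [*]) (by omega) ?_
  refine runs_load (u := 16 * R + 5) (by simp) hst.1 ?_
  refine runs_add (v := 16 * R + 6) (by simp [*]) (by omega) ?_
  refine runs_load (u := 16 * R + 6) (by simp) hst.2 ?_
  refine runs_add (v := y + 1) (by simp [*]) (by omega) ?_
  have hout : ∀ (r₂ : ℕ → ℕ) (c : ℕ), r₂ 1 = c → r₂ 9 = 1 → c ≤ m →
      Runs w mem (seqs [.op .sub 0 1 9]) r₂ 1 fun r' =>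
        output r' = if c = 0 then ⊥ else ((c - 1 : ℕ) : WithBot ℕ) := by
    intro r₂ c k1 k9 hcm
    rcases Nat.eq_zero_or_pos c with rfl | hc
    -- For the code `0` the subtraction wraps around, but register 0 is not read then.
    · exact runs_op rfl (runs_nil (by simp [output, k1]))
    · refine runs_sub (v := c - 1) (by simp [*]) (by omega) (by omega) (runs_nil ?_)
      simp [output, k1]
  refine runs_cons (T' := 1) (runs_ifLt (T := 1) (fun hlt => ?_) (fun hge => ?_))
  · simp at hlt
    rw [if_neg (by omega : ¬ hi ≤ y + 1)]
    refine runs_copy (v := lo) (by simp) (runs_nil (hout _ lo (by simp) (by simp [*]) hlo))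
  · simp at hge
    rw [if_pos hge]
    refine runs_copy (v := hi) (by simp) (runs_nil (hout _ hi (by simp) (by simp [*]) hhi))

/-- The query program. -/
def predQuery : Prog := seqs [initProg, .whileLt 1 12 stepProg, answerProg]

lemma runs_predQuery {κ m L p a s y : ℕ} {S : Finset ℕ} (E : IsEncoding w κ m L S mem p a s)
    (hy : y < m) :
    Runs w mem predQuery (input y) (61 * Nat.log 2 L + 119) fun r' => output r' = pred S y := by
  refine Runs.mono (T := (40 + ((Nat.log 2 L + 1) * (60 + 1) + 1)) + 17) ?_ (by omega)
    fun _ h => h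
  refine runs_cons ((runs_initProg E).mono le_rfl fun r₁ h₁ => ?_)
  refine runs_cons ((runs_whileLt (SearchInv κ m L p a s y S) ?_ ?_ _ h₁).mono le_rfl
    fun r₂ h₂ => ?_)
  · intro r h
    have := h.step_eq
    simp at this
    omega
  · intro n r h
    refine ⟨?_, runs_stepProg E hy h⟩
    rw [h.params.zero, h.step_eq, pow_succ]
    simp
  · exact runs_cons (T' := 0) ((runs_answerProg E hy h₂).mono le_rfl fun r₃ h₃ => runs_nil h₃)

end WordRAM

/-! ### The memory contents -/

open WordRAM

/-- The keys of the dictionary are those of the handles, of the prefixes of level `L`, and of the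
children of the branching prefixes. -/
lemma exists_dictionary_keys {κ N m L : ℕ} {S : Finset ℕ}
    (hS : S ⊆ Finset.range m) (hcard : S.card ≤ N) (hL : m ≤ N * 2 ^ (κ * L)) :
    ∃ K : Finset ℕ, K.card ≤ 3 * (N * 2 ^ κ) ∧ (∀ x ∈ K, x < (L + 1) * m) ∧
      (∀ j b f, Handle κ S L j b f → f * m + pfx κ f b ∈ K) ∧
      ∀ f ≤ L, ∀ y < m, (f = L ∨ Branch κ S (f + 1) y) → f * m + pfx κ f y ∈ K := by
  classical
  have hlt : ∀ f ≤ L, ∀ y < m, f * m + pfx κ f y < (L + 1) * m := by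
    intro f hf y hy
    have h1 : (f + 1) * m ≤ (L + 1) * m := Nat.mul_le_mul_right _ (by omega)
    have h2 := pfx_le_self κ f y
    rw [Nat.succ_mul] at h1
    omega
  -- A key of `S` opens at most one branching prefix, so it accounts for one handle `u b` and for
  -- the `2 ^ κ` children `v b + i` of one branching prefix.
  have h1 : ∀ b, ∃ x, ∀ j f, Handle κ S L j b f → f * m + pfx κ f b = x := by
    intro b
    by_cases h : ∃ j f, Handle κ S L j b f
    · obtain ⟨j, f, h⟩ := h
      exact ⟨f * m + pfx κ f b, fun j' f' h' => by rw [(h'.unique h).2]⟩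
    · exact ⟨0, fun j f h' => (h ⟨j, f, h'⟩).elim⟩
  have h2 : ∀ b, ∃ x, ∀ j, Opens κ S j b → (j - 1) * m + pfx κ j b * 2 ^ κ = x := by
    intro b
    by_cases h : ∃ j, Opens κ S j b
    · obtain ⟨j, h⟩ := h
      exact ⟨_, fun j' h' => by rw [h'.unique h]⟩
    · exact ⟨0, fun j h' => (h ⟨j, h'⟩).elim⟩
  choose u hu using h1
  choose v hv using h2
  refine ⟨(S.image u ∪ (S ×ˢ Finset.range (2 ^ κ)).image (fun q => v q.1 + q.2) ∪
    (Finset.range N).image (L * m + ·)).filter (· < (L + 1) * m), ?_,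
    fun x hx => (Finset.mem_filter.1 hx).2, fun j b f h => ?_, fun f hf y hy h => ?_⟩
  · refine (Finset.card_filter_le _ _).trans ((Finset.card_union_le _ _).trans ?_)
    refine (Nat.add_le_add (Finset.card_union_le _ _) Finset.card_image_le).trans ?_
    refine (Nat.add_le_add (Nat.add_le_add Finset.card_image_le Finset.card_image_le)
      le_rfl).trans ?_
    rw [Finset.card_product, Finset.card_range, Finset.card_range]
    have : 1 ≤ 2 ^ κ := Nat.one_le_two_pow
    have h3 : N * 1 ≤ N * 2 ^ κ := Nat.mul_le_mul_left _ this
    have h4 : S.card * 2 ^ κ ≤ N * 2 ^ κ := Nat.mul_le_mul_right _ hcard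
    omega
  · have hb := h.1.1
    simp only [Finset.mem_filter, Finset.mem_union]
    refine ⟨Or.inl (Or.inl (Finset.mem_image.2 ⟨b, hb, (hu b j f h).symm⟩)), ?_⟩
    exact hlt f h.2.2.1 b (Finset.mem_range.1 (hS hb))
  · simp only [Finset.mem_filter, Finset.mem_union]
    refine ⟨?_, hlt f hf y hy⟩
    rcases h with rfl | h
    · refine Or.inr (Finset.mem_image.2 ⟨pfx κ f y, ?_, rfl⟩)
      rw [Finset.mem_range]
      refine Nat.div_lt_of_lt_mul ?_
      rw [mul_comm]
      omega
    · obtain ⟨b, hb, hby⟩ := h.exists_opens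
      refine Or.inl (Or.inr (Finset.mem_image.2 ⟨(b, pfx κ f y % 2 ^ κ), ?_, ?_⟩))
      · rw [Finset.mem_product, Finset.mem_range]
        exact ⟨hb.1, Nat.mod_lt _ (by positivity)⟩
      · have := hv b _ hb
        rw [hby, pfx_succ, Nat.add_sub_cancel] at this
        change v b + pfx κ f y % 2 ^ κ = _
        rw [← this, add_assoc, Nat.div_add_mod']

/-- The record to be stored in a row, for an injective hash function `h` on the dictionary keys
`K`. -/
lemma exists_records {κ m L : ℕ} {S K : Finset ℕ} {h : ℕ → ℕ} (hS : S ⊆ Finset.range m)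
    (hinj : Set.InjOn h (K : Set ℕ)) (row : ℕ) :
    ∃ j b lo hi, j ≤ L + 1 ∧ b ≤ m ∧ lo ≤ m ∧ hi ≤ m ∧
      (j = L + 1 ∧ b = 0 ∨ ∃ f, Handle κ S L j b f) ∧
      (∀ f y, y < m → f * m + pfx κ f y ∈ K → h (f * m + pfx κ f y) = row →
        ((∃ j b, Handle κ S L j b f ∧ pfx κ f b = pfx κ f y) →
          Handle κ S L j b f ∧ pfx κ f b = pfx κ f y) ∧
        lo = (S.filter fun x => pfx κ f x < pfx κ f y).sup (· + 1) ∧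
        hi = (S.filter fun x => pfx κ f x ≤ pfx κ f y).sup (· + 1)) := by
  have hSm : ∀ x ∈ S, x < m := fun x hx => Finset.mem_range.1 (hS hx)
  have hsup : ∀ q : ℕ → Prop, ∀ _ : DecidablePred q, (S.filter q).sup (· + 1) ≤ m := fun q _ =>
    Finset.sup_le fun x hx => hSm x (Finset.mem_filter.1 hx).1
  by_cases hx : ∃ x ∈ K, h x = row
  swap
  · refine ⟨L + 1, 0, 0, 0, le_rfl, zero_le, zero_le, zero_le, Or.inl ⟨rfl, rfl⟩, ?_⟩
    intro f y _ hK hrow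
    exact (hx ⟨_, hK, hrow⟩).elim
  obtain ⟨x, hxK, hxr⟩ := hx
  have hdec : ∀ f y, y < m → f * m + pfx κ f y ∈ K → h (f * m + pfx κ f y) = row →
      f = x / m ∧ pfx κ f y = x % m := by
    intro f y hy hK hrow
    have hlt : pfx κ f y < m := (pfx_le_self κ f y).trans_lt hy
    rw [← hinj hK hxK (hrow.trans hxr.symm)]
    constructor
    · rw [mul_comm, Nat.mul_add_div (by omega), Nat.div_eq_of_lt hlt, add_zero]
    · rw [mul_comm, Nat.mul_add_mod, Nat.mod_eq_of_lt hlt]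
  by_cases hH : ∃ j b, Handle κ S L j b (x / m) ∧ pfx κ (x / m) b = x % m
  · obtain ⟨j, b, hh, hb⟩ := hH
    refine ⟨j, b, (S.filter fun z => pfx κ (x / m) z < x % m).sup (· + 1),
      (S.filter fun z => pfx κ (x / m) z ≤ x % m).sup (· + 1), ?_, (hSm b hh.1.1).le,
      hsup _ _, hsup _ _, Or.inr ⟨_, hh⟩, fun f y hy hK hrow => ?_⟩
    · have := hh.2.1; have := hh.2.2.1; omega
    · obtain ⟨rfl, hq⟩ := hdec f y hy hK hrow
      rw [hq]
      exact ⟨fun _ => ⟨hh, hb⟩, rfl, rfl⟩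
  · refine ⟨L + 1, 0, (S.filter fun z => pfx κ (x / m) z < x % m).sup (· + 1),
      (S.filter fun z => pfx κ (x / m) z ≤ x % m).sup (· + 1), le_rfl, zero_le,
      hsup _ _, hsup _ _, Or.inl ⟨rfl, rfl⟩, fun f y hy hK hrow => ?_⟩
    obtain ⟨rfl, hq⟩ := hdec f y hy hK hrow
    rw [hq]
    exact ⟨fun h => (hH h).elim, rfl, rfl⟩

/-- The memory made of `R` rows of 16 words, where word `k` of row `i` is `col k i`. -/
def tableMem (R : ℕ) (col : ℕ → ℕ → ℕ) : List ℕ :=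
  (List.range (16 * R)).map fun a => col (a % 16) (a / 16)

lemma getD_tableMem {R : ℕ} {col : ℕ → ℕ → ℕ} {i k : ℕ} (hi : i < R) (hk : k < 16) :
    (tableMem R col).getD (16 * i + k) 0 = col k i := by
  have h1 : 16 * i + k < 16 * R := by omega
  have h2 : (16 * i + k) % 16 = k := by omega
  have h3 : (16 * i + k) / 16 = i := by omega
  simp [tableMem, h1, h2, h3]

theorem exists_encoding {κ N m L : ℕ} {S : Finset ℕ} (hm : 2 ≤ m) (hN : 1 ≤ N)
    (hNm : N ≤ m) (hS : S ⊆ Finset.range m) (hcard : S.card ≤ N) (hL : m ≤ N * 2 ^ (κ * L))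
    (hκl : κ ≤ Nat.clog 2 m) (hLl : L ≤ Nat.clog 2 m) :
    ∃ mem p a s, IsEncoding (wordLength 16 m) κ m L S mem p a s ∧
      (∀ v ∈ mem, v < 2 ^ wordLength 16 m) ∧ mem.length ≤ 336 * (N * 2 ^ κ) := by
  obtain ⟨K, hKc, hKU, hKH, hKT⟩ := exists_dictionary_keys (κ := κ) (L := L) hS hcard hL
  obtain ⟨p, hp, hUp, hpU⟩ := Nat.exists_prime_lt_and_le_two_mul ((L + 1) * m) (by positivity)
  -- All numbers involved are polynomial in `X = 2 ^ clog m`, and the word length allows for `X ^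
  -- 16`.
  set X := 2 ^ Nat.clog 2 m with hX
  have hmX : m ≤ X := Nat.le_pow_clog (by norm_num) m
  have hlX : Nat.clog 2 m + 1 ≤ X := Nat.lt_two_pow_self
  have hX2 : 2 ≤ X := hm.trans hmX
  have hw : 2 ^ wordLength 16 m = X ^ 16 := by
    rw [wordLength, mul_comm, pow_mul]
  have hκX : 2 ^ κ ≤ X := Nat.pow_le_pow_right (by norm_num) hκl
  have hXX : ∀ c n k : ℕ, c ≤ 2 ^ k → n + k ≤ 15 → c * X ^ n < X ^ 16 := by
    intro c n k hc hnk
    calc c * X ^ n ≤ X ^ k * X ^ n :=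
          Nat.mul_le_mul_right _ (hc.trans (Nat.pow_le_pow_left hX2 k))
      _ = X ^ (n + k) := by rw [← pow_add, add_comm]
      _ < X ^ 16 := Nat.pow_lt_pow_right (by omega) (by omega)
  have hU : (L + 1) * m ≤ X ^ 2 := by
    rw [sq]; exact Nat.mul_le_mul (by omega) hmX
  have hp2 : p ≤ 2 * X ^ 2 := by omega
  have hpp : p * p ≤ 4 * X ^ 4 := by
    calc p * p ≤ (2 * X ^ 2) * (2 * X ^ 2) := Nat.mul_le_mul hp2 hp2
      _ = 4 * X ^ 4 := by ring
  have hpX : p < X ^ 16 := hp2.trans_lt (hXX 2 2 1 (by norm_num) (by norm_num))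
  set M := 3 * (N * 2 ^ κ) with hM
  have hM0 : 0 < M := by positivity
  have hMX : M ≤ 3 * X ^ 2 := by
    rw [hM, sq]; exact Nat.mul_le_mul_left _ (Nat.mul_le_mul (hNm.trans hmX) hκX)
  have hmX16 : m < X ^ 16 := by
    have := hXX 1 1 0 (by norm_num) (by norm_num)
    rw [one_mul, pow_one] at this
    omega
  have hLX16 : L + 1 < X ^ 16 := by
    have := hXX 1 1 0 (by norm_num) (by norm_num)
    rw [one_mul, pow_one] at this
    omega
  have hRX : 16 * (7 * M) < X ^ 16 := by
    have := hXX 336 2 9 (by norm_num) (by norm_num)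
    omega
  have hlog : 2 ^ Nat.log 2 L ≤ L + 1 := by
    rcases Nat.eq_zero_or_pos L with rfl | hL
    · simp
    · exact (Nat.pow_log_le_self 2 hL.ne').trans (Nat.le_succ L)
  have hword : 32 * (m + κ + L + κ * (L + 1)) < X ^ 16 := by
    have h1 : κ * (L + 1) ≤ X * X := Nat.mul_le_mul (by omega) (by omega)
    have h2 : 1 * X ≤ X * X := Nat.mul_le_mul_right _ (by omega)
    have h3 := hXX 128 2 7 (by norm_num) (by norm_num)
    rw [sq] at h3
    omega
  obtain ⟨a, A, O, Z, ha, hA, hZ, hOZ, hinj⟩ := exists_perfect_hash hp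
    (fun x hx => (hKU x hx).trans hUp) hKc hM0
  choose J B Lo Hi hJ hB hLo hHi hsound hspec using
    fun row => exists_records (κ := κ) (L := L) hS hinj row
  -- The parameters of the query occupy words 8 to 14 of every row; they are read from row 0.
  let cols : ℕ → ℕ → ℕ := fun k i => match k with
    | 0 => if i < M then A i else 0
    | 1 => if i < M then O i else 0
    | 2 => if i < M then Z i else 0
    | 3 => J i
    | 4 => B i
    | 5 => Lo i
    | 6 => Hi i
    | 8 => κ
    | 9 => m
    | 10 => p
    | 11 => a
    | 12 => M
    | 13 => L + 1
    | 14 => 2 ^ Nat.log 2 L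
    | _ => 0
  have hget : ∀ i k, i < 7 * M → k < 16 → (tableMem (7 * M) cols).getD (16 * i + k) 0 = cols k i :=
    fun i k hi hk => getD_tableMem hi hk
  have hhead : ∀ k, k < 16 → (tableMem (7 * M) cols).getD k 0 = cols k 0 := by
    intro k hk
    simpa using hget 0 k (by omega) hk
  have hcA : ∀ i < M, (tableMem (7 * M) cols).getD (16 * i) 0 = A i := by
    intro i hi
    have := hget i 0 (by omega) (by norm_num)
    rw [add_zero] at this
    exact this.trans (if_pos hi)
  have hcO : ∀ i < M, (tableMem (7 * M) cols).getD (16 * i + 1) 0 = O i := by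
    intro i hi
    exact (hget i 1 (by omega) (by norm_num)).trans (if_pos hi)
  have hcZ : ∀ i < M, (tableMem (7 * M) cols).getD (16 * i + 2) 0 = Z i := by
    intro i hi
    exact (hget i 2 (by omega) (by norm_num)).trans (if_pos hi)
  have hrow : ∀ x, hashRow (tableMem (7 * M) cols) p a M x = O (a * x % p % M) +
      A (a * x % p % M) * x % p % Z (a * x % p % M) := by
    intro x
    have hi : a * x % p % M < M := Nat.mod_lt _ hM0
    rw [hashRow, hcA _ hi, hcO _ hi, hcZ _ hi]
  have hrowlt : ∀ x, hashRow (tableMem (7 * M) cols) p a M x < 7 * M := by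
    intro x
    have hi : a * x % p % M < M := Nat.mod_lt _ hM0
    rw [hrow]
    have h1 := Nat.mod_lt (A (a * x % p % M) * x % p) (hZ _ hi)
    have h2 := hOZ _ hi
    omega
  refine ⟨tableMem (7 * M) cols, p, a, M, ?_, ?_, ?_⟩
  · constructor
    · exact hhead 8 (by norm_num)
    · exact hhead 9 (by norm_num)
    · exact hhead 10 (by norm_num)
    · exact hhead 11 (by norm_num)
    · exact hhead 12 (by norm_num)
    · exact hhead 13 (by norm_num)
    · exact hhead 14 (by norm_num)
    · exact hm
    · rwa [hw]
    · exact hUp.le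
    · exact ha
    · rw [hw]
      exact hpp.trans (hXX 4 4 2 (by norm_num) (by norm_num)).le
    · exact hM0
    · rw [hw]; omega
    · intro i hi
      rw [hcA i hi]
      exact hA i hi
    · intro x _
      have := hrowlt x
      rw [hw]; omega
    · intro x _
      rw [hget _ 3 (hrowlt x) (by norm_num), hget _ 4 (hrowlt x) (by norm_num)]
      exact hsound _
    · intro f hf y hy hex
      rw [hget _ 3 (hrowlt _) (by norm_num), hget _ 4 (hrowlt _) (by norm_num)]
      refine (hspec _ f y hy ?_ (hrow _).symm).1 hex
      obtain ⟨j, b, h1, h2⟩ := hex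
      rw [← h2]
      exact hKH j b f h1
    · intro f hf y hy hbr
      rw [hget _ 5 (hrowlt _) (by norm_num), hget _ 6 (hrowlt _) (by norm_num)]
      exact (hspec _ f y hy (hKT f hf y hy hbr) (hrow _).symm).2
    · exact fun x hx => Finset.mem_range.1 (hS hx)
  · intro v hv
    rw [tableMem, List.mem_map] at hv
    obtain ⟨c, -, rfl⟩ := hv
    rw [hw]
    generalize c / 16 = i
    have hk : c % 16 < 16 := Nat.mod_lt _ (by norm_num)
    generalize c % 16 = k at hk
    have h1 := hJ i
    have h2 := hB i
    have h3 := hLo i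
    have h4 := hHi i
    have hX0 : 0 < X ^ 16 := by positivity
    have hite : ∀ t : ℕ, (i < M → t < X ^ 16) → (if i < M then t else 0) < X ^ 16 := by
      intro t ht
      split_ifs with h
      · exact ht h
      · exact hX0
    have h5 := hite (A i) fun h => by have := hA i h; omega
    have h6 := hite (O i) fun h => by have := hOZ i h; omega
    have h7 := hite (Z i) fun h => by have := hOZ i h; omega
    interval_cases k <;> simp only [cols] <;> omega
  · simp only [tableMem, List.length_map, List.length_range]
    omega

/-! ### Space and time -/

open Filter

lemma max_one_logb_le {x y : ℝ} (hx : 0 ≤ x) (hxy : x ≤ y) :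
    max 1 (Real.logb 2 x) ≤ max 1 (Real.logb 2 y) := by
  rcases hx.eq_or_lt with rfl | hx
  · simp
  · exact max_le_max le_rfl (Real.logb_le_logb_of_le (by norm_num) hx hxy)

/-- The minimality of the number `L` of levels bounds the number of rounds of the search. -/
lemma log_levels_le {κ N m L : ℕ} (hκ : 1 ≤ κ) (hN : 1 ≤ N)
    (hL : 2 ≤ L → N * 2 ^ (κ * (L - 1)) < m) :
    (Nat.log 2 L : ℝ) ≤ 1 + max 1 (Real.logb 2 ((Real.logb 2 m - Real.logb 2 N) / κ)) := by
  rcases lt_or_ge L 2 with hL2 | hL2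
  · have : Nat.log 2 L = 0 := Nat.log_of_lt hL2
    rw [this]
    have := le_max_left (1 : ℝ) (Real.logb 2 ((Real.logb 2 m - Real.logb 2 N) / κ))
    push_cast
    linarith
  · have hlt := hL hL2
    have hκ' : (0 : ℝ) < κ := by exact_mod_cast hκ
    have hN' : (0 : ℝ) < N := by exact_mod_cast hN
    have hL' : (2 : ℝ) ≤ L := by exact_mod_cast hL2
    have h1 : Real.logb 2 N + κ * ((L : ℝ) - 1) ≤ Real.logb 2 m := by
      have h2 : Real.logb 2 ((N * 2 ^ (κ * (L - 1)) : ℕ) : ℝ) ≤ Real.logb 2 m :=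
        Real.logb_le_logb_of_le (by norm_num) (by positivity) (by exact_mod_cast hlt.le)
      rw [Nat.cast_mul, Real.logb_mul hN'.ne' (by positivity), Nat.cast_pow, Real.logb_pow] at h2
      simp only [Nat.cast_ofNat, Nat.cast_mul] at h2
      rw [Real.logb_self_eq_one (by norm_num), Nat.cast_sub (by omega)] at h2
      simpa using h2
    have h3 : (L : ℝ) / 2 ≤ (Real.logb 2 m - Real.logb 2 N) / κ := by
      rw [le_div_iff₀ hκ']
      nlinarith
    have h4 : Real.logb 2 ((L : ℝ) / 2) ≤ Real.logb 2 ((Real.logb 2 m - Real.logb 2 N) / κ) :=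
      Real.logb_le_logb_of_le (by norm_num) (by positivity) h3
    rw [Real.logb_div (by positivity) (by norm_num), Real.logb_self_eq_one (by norm_num)] at h4
    have h5 : (Nat.log 2 L : ℝ) ≤ Real.logb 2 L := by
      exact_mod_cast Real.natLog_le_logb L 2
    have h6 := le_max_right (1 : ℝ) (Real.logb 2 ((Real.logb 2 m - Real.logb 2 N) / κ))
    linarith

lemma clog_le_two_mul_logb {m : ℕ} (hm : 2 ≤ m) : (Nat.clog 2 m : ℝ) ≤ 2 * Real.logb 2 m := by
  have h1 : 2 ^ (Nat.clog 2 m - 1) < m := Nat.pow_pred_clog_lt_self (by norm_num) (by omega)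
  have h2 : 1 ≤ Nat.clog 2 m := Nat.clog_pos (by norm_num) hm
  have h3 : Real.logb 2 ((2 ^ (Nat.clog 2 m - 1) : ℕ) : ℝ) ≤ Real.logb 2 m :=
    Real.logb_le_logb_of_le (by norm_num) (by positivity) (by exact_mod_cast h1.le)
  have h4 : Real.logb 2 2 ≤ Real.logb 2 (m : ℝ) :=
    Real.logb_le_logb_of_le (by norm_num) (by norm_num) (by exact_mod_cast hm)
  rw [Nat.cast_pow, Real.logb_pow, Nat.cast_sub h2] at h3
  simp only [Nat.cast_ofNat, Nat.cast_one] at h3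
  rw [Real.logb_self_eq_one (by norm_num)] at h3 h4
  linarith

theorem exists_isPredStructure {κ N m : ℕ} {S : Finset ℕ} (hκ : 1 ≤ κ) (hm : 2 ≤ m) (hN : 1 ≤ N)
    (hNm : N ≤ m) (hS : S ⊆ Finset.range m) (hcard : S.card ≤ N) :
    ∃ mem, IsPredStructure predQuery 16 m S mem
      (10752 * (N * 2 ^ κ * Real.logb 2 m))
      (10752 * max 1 (Real.logb 2 ((Real.logb 2 m - Real.logb 2 N) / κ))) := by
  classical
  have hmpow : m ≤ 2 ^ Nat.clog 2 m := Nat.le_pow_clog (by norm_num) m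
  have hl1 : 1 ≤ Nat.clog 2 m := Nat.clog_pos (by norm_num) hm
  -- A larger `κ` would not fit into a word, and would not reduce the number of levels below 1.
  set κ' := min κ (Nat.clog 2 m) with hκ'
  have hκ1 : 1 ≤ κ' := le_min hκ hl1
  have hbig : ∀ L, Nat.clog 2 m ≤ κ' * L → m ≤ N * 2 ^ (κ' * L) := fun L hL =>
    calc m ≤ 2 ^ Nat.clog 2 m := hmpow
      _ ≤ 2 ^ (κ' * L) := Nat.pow_le_pow_right (by norm_num) hL
      _ ≤ N * 2 ^ (κ' * L) := Nat.le_mul_of_pos_left _ hN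
  have hex : ∃ L, m ≤ N * 2 ^ (κ' * L) :=
    ⟨Nat.clog 2 m, hbig _ (Nat.le_mul_of_pos_left _ hκ1)⟩
  set L := Nat.find hex with hL
  have hLl : L ≤ Nat.clog 2 m := Nat.find_min' hex (hbig _ (Nat.le_mul_of_pos_left _ hκ1))
  have hLmin : ∀ L' < L, N * 2 ^ (κ' * L') < m := fun L' h => not_le.1 (Nat.find_min hex h)
  obtain ⟨mem, p, a, s, hE, hmem, hlen⟩ :=
    exists_encoding hm hN hNm hS hcard (Nat.find_spec hex) (min_le_right _ _) hLl
  rw [← hL] at hE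
  refine ⟨mem, ?_, hmem, fun y hy => ?_⟩
  · have h1 : (mem.length : ℝ) ≤ 336 * (N * 2 ^ κ) := by
      have h2 : N * 2 ^ κ' ≤ N * 2 ^ κ :=
        Nat.mul_le_mul_left _ (Nat.pow_le_pow_right (by norm_num) (min_le_left _ _))
      have h3 : mem.length ≤ 336 * (N * 2 ^ κ) := by omega
      exact_mod_cast h3
    have h4 := clog_le_two_mul_logb hm
    rw [spaceBits, wordLength]
    push_cast
    calc (mem.length : ℝ) * (16 * Nat.clog 2 m)
        ≤ (336 * (N * 2 ^ κ)) * (16 * (2 * Real.logb 2 m)) := by gcongr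
      _ = 10752 * (N * 2 ^ κ * Real.logb 2 m) := by ring
  · obtain ⟨t, r, h1, h2, h3⟩ := runs_predQuery hE hy
    refine ⟨t, r, h1, h3, ?_⟩
    have h4 := log_levels_le (m := m) (L := L) hκ hN fun hL2 => by
      rcases le_total κ (Nat.clog 2 m) with h | h
      · have := hLmin (L - 1) (by omega)
        rwa [hκ', min_eq_left h] at this
      · have h5 := hLmin 1 (by omega)
        rw [hκ', min_eq_right h] at h5
        have h6 := hbig 1 (by rw [hκ', min_eq_right h, mul_one])
        rw [hκ', min_eq_right h] at h6
        omega
    have h5 := le_max_left (1 : ℝ) (Real.logb 2 ((Real.logb 2 m - Real.logb 2 N) / κ))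
    have h6 : (t : ℝ) ≤ 61 * Nat.log 2 L + 119 := by exact_mod_cast h2
    linarith

/-! ### The encoded representatives -/

lemma tendsto_logb_natCast : Tendsto (fun n : ℕ => Real.logb 2 (n : ℝ)) atTop atTop :=
  (Real.tendsto_logb_atTop (by norm_num)).comp tendsto_natCast_atTop_atTop

lemma eventually_logb_add_le {ε : ℝ} (hε : 0 < ε) (c : ℝ) :
    ∀ᶠ x : ℝ in atTop, Real.logb 2 x + c ≤ ε * x := by
  have hlog2 : 0 < Real.log 2 := Real.log_pos (by norm_num)
  have h1 := Real.isLittleO_log_id_atTop.bound (show 0 < ε / 2 * Real.log 2 by positivity)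
  filter_upwards [h1, eventually_ge_atTop (2 * c / ε), eventually_ge_atTop 0] with x hx hc h0
  rw [Real.norm_eq_abs, id, Real.norm_eq_abs, abs_of_nonneg h0] at hx
  have h2 : Real.logb 2 x ≤ ε / 2 * x := by
    rw [Real.logb, div_le_iff₀ hlog2]
    calc Real.log x ≤ |Real.log x| := le_abs_self _
      _ ≤ _ := hx
      _ = _ := by ring
  rw [div_le_iff₀ hε] at hc
  linarith

lemma card_encodedReps_le {C₁ C₄ : ℝ} {n b : ℕ} {x : ℕ → ℕ} (h : 1 ≤ numBuckets C₄ n) :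
    (encodedReps C₁ C₄ n b x).card ≤ numBuckets C₄ n + 1 := by
  refine Finset.card_image_le.trans ((Finset.card_insert_le _ _).trans ?_)
  have h1 := Finset.card_insert_le (2 ^ b)
    ((Finset.Ioo 0 (numBuckets C₄ n)).image fun i => x (i * repGap C₄ n))
  have h2 := Finset.card_image_le (s := Finset.Ioo 0 (numBuckets C₄ n))
    (f := fun i => x (i * repGap C₄ n))
  rw [Nat.card_Ioo] at h2
  omega

lemma encodedReps_subset {C₁ C₄ : ℝ} {n b : ℕ} {x : ℕ → ℕ} (hx : IsSortedFile n b x)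
    (hgap : 1 ≤ repGap C₄ n) (hm : 1 ≤ numParts C₁ n) :
    encodedReps C₁ C₄ n b x ⊆ Finset.range (numParts C₁ n) := by
  intro z hz
  rw [encodedReps, Finset.mem_image] at hz
  obtain ⟨y, hy, rfl⟩ := hz
  have hyb : y ≤ 2 ^ b := by
    simp only [representatives, Finset.mem_insert, Finset.mem_image, Finset.mem_Ioo] at hy
    rcases hy with rfl | rfl | ⟨i, ⟨hi0, hi⟩, rfl⟩
    · exact Nat.zero_le _
    · exact le_rfl
    · refine hx.2 _ ⟨Nat.mul_pos hi0 hgap, ?_⟩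
      exact (Nat.mul_le_mul_right _ hi.le).trans (Nat.div_mul_le_self _ _)
  rw [Finset.mem_range]
  refine Nat.div_lt_of_lt_mul ?_
  have h1 : 2 ^ b + 1 ≤ numParts C₁ n • partSize b (numParts C₁ n) := le_smul_ceilDiv hm
  rw [smul_eq_mul, mul_comm] at h1
  omega

lemma le_numParts {C₁ : ℝ} (hC₁ : 1 < C₁) {n : ℕ} (hn : 1 ≤ n) : n ≤ numParts C₁ n := by
  refine Nat.le_floor ?_
  calc (n : ℝ) = (n : ℝ) ^ (1 : ℝ) := (Real.rpow_one _).symm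
    _ ≤ (n : ℝ) ^ C₁ := Real.rpow_le_rpow_of_exponent_le (by exact_mod_cast hn) hC₁.le

lemma logb_numParts_le {C₁ : ℝ} (hC₁ : 1 < C₁) {n : ℕ} (hn : 1 ≤ n) :
    Real.logb 2 (numParts C₁ n) ≤ C₁ * Real.logb 2 n := by
  have hn' : (0 : ℝ) < n := by exact_mod_cast hn
  rw [← Real.logb_rpow_eq_mul_logb_of_pos hn']
  refine Real.logb_le_logb_of_le (by norm_num) ?_ (Nat.floor_le (by positivity))
  exact_mod_cast hn.trans (le_numParts hC₁ hn)

lemma numBuckets_add_one_mul_logb_le {C₁ C₄ : ℝ} (hC₁ : 1 < C₁) (hC₄ : 0 < C₄) {n : ℕ}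
    (hn : 2 ≤ n) :
    ((numBuckets C₄ n + 1 : ℕ) : ℝ) * Real.logb 2 (numParts C₁ n) ≤ (C₁ / C₄ + C₁) * n := by
  have hn' : (0 : ℝ) < n := by positivity
  have hl : 0 < Real.logb 2 n := Real.logb_pos (by norm_num) (by exact_mod_cast hn)
  have h1 : (numBuckets C₄ n : ℝ) ≤ n / (C₄ * Real.logb 2 n) :=
    calc (numBuckets C₄ n : ℝ) ≤ (n : ℝ) / (repGap C₄ n : ℝ) := Nat.cast_div_le
      _ ≤ n / (C₄ * Real.logb 2 n) := by
        gcongr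
        exact Nat.le_ceil _
  have h2 : Real.logb 2 (n : ℝ) ≤ n := by
    rw [Real.logb_le_iff_le_rpow (by norm_num) hn', Real.rpow_natCast]
    exact_mod_cast Nat.lt_two_pow_self.le
  calc ((numBuckets C₄ n + 1 : ℕ) : ℝ) * Real.logb 2 (numParts C₁ n)
      ≤ (n / (C₄ * Real.logb 2 n) + 1) * (C₁ * Real.logb 2 n) := by
        push_cast
        exact mul_le_mul (by linarith) (logb_numParts_le hC₁ (by omega))
          (Real.logb_nonneg (by norm_num) (by
            exact_mod_cast (show 1 ≤ n by omega).trans (le_numParts hC₁ (by omega))))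
          (by positivity)
    _ = C₁ / C₄ * n + C₁ * Real.logb 2 n := by field_simp
    _ ≤ C₁ / C₄ * n + C₁ * n := by gcongr
    _ = _ := by ring

lemma logb_numParts_sub_le {C₁ C₄ : ℝ} (hC₁ : 1 < C₁) (hC₄ : 0 < C₄) {n : ℕ} (hn : 2 ≤ n) :
    Real.logb 2 (numParts C₁ n) - Real.logb 2 ((numBuckets C₄ n + 1 : ℕ) : ℝ) ≤
      (C₁ - 1) * Real.logb 2 n + (Real.logb 2 (Real.logb 2 n) + Real.logb 2 (C₄ + 1)) := by
  have hn' : (0 : ℝ) < n := by positivity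
  have hl : 1 ≤ Real.logb 2 n := by
    rw [Real.le_logb_iff_rpow_le (by norm_num) hn', Real.rpow_one]
    exact_mod_cast hn
  have hgap0 : 0 < repGap C₄ n := Nat.ceil_pos.2 (by positivity)
  have hgap : (repGap C₄ n : ℝ) ≤ (C₄ + 1) * Real.logb 2 n := by
    have := (Nat.ceil_lt_add_one (show 0 ≤ C₄ * Real.logb 2 n by positivity)).le
    rw [repGap]
    linarith
  have h1 : (n : ℝ) ≤ ((numBuckets C₄ n + 1 : ℕ) : ℝ) * ((C₄ + 1) * Real.logb 2 n) := by
    have h2 : n ≤ (numBuckets C₄ n + 1) * repGap C₄ n := by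
      rw [mul_comm]
      exact (Nat.lt_mul_div_succ n hgap0).le
    calc (n : ℝ) ≤ ((numBuckets C₄ n + 1 : ℕ) : ℝ) * (repGap C₄ n : ℝ) := by exact_mod_cast h2
      _ ≤ _ := by gcongr
  have h3 := Real.logb_le_logb_of_le (b := 2) (by norm_num) hn' h1
  rw [Real.logb_mul (by positivity) (by positivity),
    Real.logb_mul (by positivity) (by positivity)] at h3
  have h4 := logb_numParts_le hC₁ (show 1 ≤ n by omega)
  linarith

/-- `n` is large enough for the buckets of the file to be proper: there is a complete one, and it
has at least two keys. -/
structure RegularSize (C₄ : ℝ) (n : ℕ) : Prop where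
  two_le : 2 ≤ n
  gap_le : repGap C₄ n ≤ n
  two_le_gap : 2 ≤ repGap C₄ n

lemma eventually_regularSize {C₄ : ℝ} (hC₄ : 0 < C₄) :
    ∀ᶠ n : ℕ in atTop, RegularSize C₄ n := by
  have h1 := tendsto_natCast_atTop_atTop.eventually
    (eventually_logb_add_le (show 0 < 1 / C₄ by positivity) (1 / C₄))
  filter_upwards [h1, eventually_ge_atTop 2, tendsto_logb_natCast.eventually_gt_atTop (1 / C₄)]
    with n h1 h2 h3
  refine ⟨h2, Nat.ceil_le.2 ?_, ?_⟩
  · have := mul_le_mul_of_nonneg_left h1 hC₄.le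
    field_simp at this
    linarith
  · refine Nat.lt_ceil.2 ?_
    rw [div_lt_iff₀ hC₄] at h3
    push_cast
    linarith

/-- The bounds of a predecessor structure on the encoded representatives, in terms of `κ` and of an
upper bound `D` of `log m - log N`. -/
theorem isPredStructure_encodedReps {query : Prog} {c : ℕ}
    {build : ℕ → ℕ → ℕ → Finset ℕ → List ℕ} {K : ℝ} (hK : 0 ≤ K)
    (H : ∀ (κ N m : ℕ) (S : Finset ℕ), 1 ≤ κ → 2 ≤ m → 1 ≤ N → N ≤ m →
        S ⊆ Finset.range m → S.card ≤ N →
        IsPredStructure query c m S (build κ N m S)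
          (K * (N * 2 ^ κ * Real.logb 2 m))
          (K * max 1 (Real.logb 2 ((Real.logb 2 m - Real.logb 2 N) / κ))))
    {C₁ C₄ : ℝ} (hC₁ : 1 < C₁) (hC₄ : 0 < C₄) {n : ℕ} (hn : RegularSize C₄ n) {κ : ℕ}
    (hκ : 1 ≤ κ) {D B T : ℝ}
    (hD : (C₁ - 1) * Real.logb 2 n + (Real.logb 2 (Real.logb 2 n) + Real.logb 2 (C₄ + 1)) ≤ D)
    (hB : K * ((C₁ / C₄ + C₁) * n * 2 ^ κ) ≤ B) (hT : K * max 1 (Real.logb 2 (D / κ)) ≤ T)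
    {b : ℕ} {x : ℕ → ℕ} (hx : IsSortedFile n b x) :
    IsPredStructure query c (numParts C₁ n) (encodedReps C₁ C₄ n b x)
      (build κ (numBuckets C₄ n + 1) (numParts C₁ n) (encodedReps C₁ C₄ n b x)) B T := by
  obtain ⟨h2, hgn, hg⟩ := hn
  have hnm : n ≤ numParts C₁ n := le_numParts hC₁ (by omega)
  have hρ : 1 ≤ numBuckets C₄ n := (Nat.one_le_div_iff (by omega)).2 hgn
  have hρn : numBuckets C₄ n + 1 ≤ n := by
    have : numBuckets C₄ n ≤ n / 2 := Nat.div_le_div_left hg (by norm_num)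
    omega
  obtain ⟨hsp, hmem, hq⟩ := H κ (numBuckets C₄ n + 1) (numParts C₁ n) (encodedReps C₁ C₄ n b x) hκ
    (h2.trans hnm) (by omega) (hρn.trans hnm) (encodedReps_subset hx (by omega) (by omega))
    (card_encodedReps_le hρ)
  refine ⟨hsp.trans (le_trans (mul_le_mul_of_nonneg_left ?_ hK) hB), hmem, fun y hy => ?_⟩
  · have := numBuckets_add_one_mul_logb_le hC₁ hC₄ h2
    calc _ = ((numBuckets C₄ n + 1 : ℕ) : ℝ) * Real.logb 2 (numParts C₁ n) * 2 ^ κ := by ring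
      _ ≤ _ := by gcongr
  · obtain ⟨t, r, ht, hr, htT⟩ := hq y hy
    refine ⟨t, r, ht, hr, htT.trans (le_trans (mul_le_mul_of_nonneg_left ?_ hK) hT)⟩
    refine max_one_logb_le (div_nonneg (sub_nonneg.2 ?_) (Nat.cast_nonneg _)) ?_
    · exact Real.logb_le_logb_of_le (by norm_num) (by positivity)
        (by exact_mod_cast hρn.trans hnm)
    · have := (logb_numParts_sub_le hC₁ hC₄ h2).trans hD
      gcongr

lemma two_pow_le_rpow {κ n : ℕ} {e : ℝ} (hn : 1 ≤ n) (h : (κ : ℝ) ≤ e * Real.logb 2 n) :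
    (2 : ℝ) ^ κ ≤ (n : ℝ) ^ e := by
  have hn' : (0 : ℝ) < n := by exact_mod_cast hn
  calc (2 : ℝ) ^ κ = (2 : ℝ) ^ (κ : ℝ) := (Real.rpow_natCast _ _).symm
    _ ≤ (2 : ℝ) ^ (Real.logb 2 n * e) :=
      Real.rpow_le_rpow_of_exponent_le (by norm_num) (by linarith)
    _ = (n : ℝ) ^ e := by
      rw [Real.rpow_mul (by norm_num), Real.rpow_logb (by norm_num) (by norm_num) hn']

lemma max_one_logb_two_mul_le {x : ℝ} (hx : 0 < x) :
    max 1 (Real.logb 2 (2 * x)) ≤ 2 * max 1 (Real.logb 2 x) := by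
  rw [Real.logb_mul (by norm_num) hx.ne', Real.logb_self_eq_one (by norm_num)]
  have h1 := le_max_left 1 (Real.logb 2 x)
  have h2 := le_max_right 1 (Real.logb 2 x)
  exact max_le (by linarith) (by linarith)

theorem mainTheorem7 :
    ∃ (query : WordRAM.Prog) (c : ℕ) (build : ℕ → ℕ → ℕ → Finset ℕ → List ℕ) (K : ℝ),
      -- one static predecessor structure, for every value of the parameter `κ`
      (∀ (κ N m : ℕ) (S : Finset ℕ), 1 ≤ κ → 2 ≤ m → 1 ≤ N → N ≤ m →
        S ⊆ Finset.range m → S.card ≤ N →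
        IsPredStructure query c m S (build κ N m S)
          (K * (N * 2 ^ κ * Real.logb 2 m))
          (K * max 1 (Real.logb 2 ((Real.logb 2 m - Real.logb 2 N) / κ)))) ∧
      -- its instances on the encoded representatives
      ∀ C₁ C₄ : ℝ, 1 < C₁ → 0 < C₄ → ∃ A : ℝ,
        -- `κ = δ log n`
        (∀ δ : ℝ, 0 < δ → ∀ᶠ n : ℕ in Filter.atTop, ∀ (b : ℕ) (x : ℕ → ℕ), IsSortedFile n b x →
          IsPredStructure query c (numParts C₁ n) (encodedReps C₁ C₄ n b x)
            (build ⌊δ * Real.logb 2 n⌋₊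
              (numBuckets C₄ n + 1) (numParts C₁ n) (encodedReps C₁ C₄ n b x))
            (A * (n : ℝ) ^ (1 + δ))
            (A * max 1 (Real.logb 2 ((C₁ - 1) / δ)))) ∧
        -- `κ = log n / log log n`
        (∀ᶠ n : ℕ in Filter.atTop, ∀ (b : ℕ) (x : ℕ → ℕ), IsSortedFile n b x →
          IsPredStructure query c (numParts C₁ n) (encodedReps C₁ C₄ n b x)
            (build ⌊Real.logb 2 n / Real.logb 2 (Real.logb 2 n)⌋₊
              (numBuckets C₄ n + 1) (numParts C₁ n) (encodedReps C₁ C₄ n b x))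
            (A * (n : ℝ) ^ (1 + 1 / Real.logb 2 (Real.logb 2 n)))
            (A * Real.logb 2 (Real.logb 2 (Real.logb 2 n)))) ∧
        Filter.Tendsto (fun n : ℕ => 1 / Real.logb 2 (Real.logb 2 (n : ℝ))) Filter.atTop
          (nhds 0) ∧
        -- `κ = 1`
        (∀ᶠ n : ℕ in Filter.atTop, ∀ (b : ℕ) (x : ℕ → ℕ), IsSortedFile n b x →
          IsPredStructure query c (numParts C₁ n) (encodedReps C₁ C₄ n b x)
            (build 1
              (numBuckets C₄ n + 1) (numParts C₁ n) (encodedReps C₁ C₄ n b x))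
            (A * n)
            (A * Real.logb 2 (Real.logb 2 n))) := by
  classical
  have hex : ∀ (κ N m : ℕ) (S : Finset ℕ), ∃ mem, 1 ≤ κ → 2 ≤ m → 1 ≤ N → N ≤ m →
      S ⊆ Finset.range m → S.card ≤ N →
      IsPredStructure predQuery 16 m S mem (10752 * (N * 2 ^ κ * Real.logb 2 m))
        (10752 * max 1 (Real.logb 2 ((Real.logb 2 m - Real.logb 2 N) / κ))) := by
    intro κ N m S
    by_cases h : 1 ≤ κ ∧ 2 ≤ m ∧ 1 ≤ N ∧ N ≤ m ∧ S ⊆ Finset.range m ∧ S.card ≤ N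
    · obtain ⟨h1, h2, h3, h4, h5, h6⟩ := h
      obtain ⟨mem, hmem⟩ := exists_isPredStructure h1 h2 h3 h4 h5 h6
      exact ⟨mem, fun _ _ _ _ _ _ => hmem⟩
    · exact ⟨[], fun h1 h2 h3 h4 h5 h6 => (h ⟨h1, h2, h3, h4, h5, h6⟩).elim⟩
  choose build H using hex
  generalize hK : (10752 : ℝ) = K at H
  have hK0 : 0 < K := by rw [← hK]; norm_num
  clear hK
  refine ⟨predQuery, 16, build, K, H, fun C₁ C₄ hC₁ hC₄ => ?_⟩
  have hC₁' : 0 < C₁ - 1 := by linarith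
  have hS0 : 0 < C₁ / C₄ + C₁ := by positivity
  have hl := tendsto_logb_natCast
  have hll : Tendsto (fun n : ℕ => Real.logb 2 (Real.logb 2 (n : ℝ))) atTop atTop :=
    (Real.tendsto_logb_atTop (by norm_num)).comp hl
  have hlll : Tendsto (fun n : ℕ => Real.logb 2 (Real.logb 2 (Real.logb 2 (n : ℝ)))) atTop
      atTop := (Real.tendsto_logb_atTop (by norm_num)).comp hll
  have hreg := eventually_regularSize hC₄
  have hDC : ∀ ε : ℝ, 0 < ε → ∀ᶠ n : ℕ in atTop, (C₁ - 1) * Real.logb 2 n +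
      (Real.logb 2 (Real.logb 2 n) + Real.logb 2 (C₄ + 1)) ≤ (C₁ - 1 + ε) * Real.logb 2 n := by
    intro ε hε
    filter_upwards [hl.eventually (eventually_logb_add_le hε (Real.logb 2 (C₄ + 1)))] with n hn
    linarith
  -- The first summand serves the space bounds and the second one the time bounds; the factors `2`
  -- are due to `2 ^ κ = 2` for `κ = 1` and to lower-order terms in the logarithms.
  set A := 2 * K * (C₁ / C₄ + C₁) + 2 * K with hA
  have hA1 : K * (C₁ / C₄ + C₁) ≤ A := by rw [hA]; nlinarith
  have hA2 : 2 * K * (C₁ / C₄ + C₁) ≤ A := by rw [hA]; nlinarith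
  have hA3 : 2 * K ≤ A := by rw [hA]; nlinarith
  refine ⟨A, fun δ hδ => ?_, ?_, ?_, ?_⟩
  · filter_upwards [hreg, hDC ((C₁ - 1) / 2) (by positivity),
      hl.eventually_ge_atTop (4 / δ)] with n hn hD hln b x hx
    have hn2 := hn.two_le
    have hn0 : (0 : ℝ) < n := by positivity
    rw [div_le_iff₀ hδ] at hln
    have hκle : (⌊δ * Real.logb 2 n⌋₊ : ℝ) ≤ δ * Real.logb 2 n := Nat.floor_le (by linarith)
    have hκlt := Nat.lt_floor_add_one (δ * Real.logb 2 n)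
    have hκ1 : 1 ≤ ⌊δ * Real.logb 2 n⌋₊ := Nat.le_floor (by push_cast; linarith)
    have hκ0 : (0 : ℝ) < ⌊δ * Real.logb 2 n⌋₊ := by exact_mod_cast hκ1
    refine isPredStructure_encodedReps hK0.le H hC₁ hC₄ hn hκ1 hD ?_ ?_ hx
    · rw [Real.rpow_add hn0, Real.rpow_one]
      calc K * ((C₁ / C₄ + C₁) * n * 2 ^ ⌊δ * Real.logb 2 n⌋₊)
          ≤ K * ((C₁ / C₄ + C₁) * n * (n : ℝ) ^ δ) := by
            gcongr
            exact two_pow_le_rpow (by omega) hκle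
        _ = K * (C₁ / C₄ + C₁) * (n * (n : ℝ) ^ δ) := by ring
        _ ≤ _ := by gcongr
    · have hratio : (C₁ - 1 + (C₁ - 1) / 2) * Real.logb 2 n / (⌊δ * Real.logb 2 n⌋₊ : ℝ) ≤
          2 * ((C₁ - 1) / δ) := by
        rw [div_le_iff₀ hκ0]
        calc (C₁ - 1 + (C₁ - 1) / 2) * Real.logb 2 n
            = 2 * ((C₁ - 1) / δ) * (3 / 4 * (δ * Real.logb 2 n)) := by field_simp; ring
          _ ≤ _ := by
            gcongr
            linarith
      have hl0 : 0 ≤ Real.logb 2 (n : ℝ) :=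
        Real.logb_nonneg (by norm_num) (by exact_mod_cast (by omega : 1 ≤ n))
      calc _ ≤ K * max 1 (Real.logb 2 (2 * ((C₁ - 1) / δ))) := by
            refine mul_le_mul_of_nonneg_left ?_ hK0.le
            exact max_one_logb_le (by positivity) hratio
        _ ≤ K * (2 * max 1 (Real.logb 2 ((C₁ - 1) / δ))) := by
            gcongr
            exact max_one_logb_two_mul_le (by positivity)
        _ = 2 * K * max 1 (Real.logb 2 ((C₁ - 1) / δ)) := by ring
        _ ≤ _ := by gcongr
  · filter_upwards [hreg, hDC 1 one_pos, hll.eventually_ge_atTop 1,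
      hlll.eventually_ge_atTop (max 1 (Real.logb 2 (2 * C₁))),
      hl.eventually (eventually_logb_add_le (show (0 : ℝ) < 1 / 2 by norm_num) 0),
      hl.eventually_ge_atTop 1] with n hn hD h1 h3 h4 hl1 b x hx
    have hn2 := hn.two_le
    have hn0 : (0 : ℝ) < n := by positivity
    set l := Real.logb 2 (n : ℝ) with hldef
    set ll := Real.logb 2 l with hlldef
    have hll0 : 0 < ll := by linarith
    have hq2 : 2 ≤ l / ll := by
      rw [le_div_iff₀ hll0]
      linarith
    have hκle : (⌊l / ll⌋₊ : ℝ) ≤ l / ll := Nat.floor_le (by linarith)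
    have hκlt := Nat.lt_floor_add_one (l / ll)
    have hκ1 : 1 ≤ ⌊l / ll⌋₊ := Nat.le_floor (by push_cast; linarith)
    have hκ0 : (0 : ℝ) < ⌊l / ll⌋₊ := by exact_mod_cast hκ1
    refine isPredStructure_encodedReps hK0.le H hC₁ hC₄ hn hκ1 hD ?_ ?_ hx
    · rw [Real.rpow_add hn0, Real.rpow_one]
      calc K * ((C₁ / C₄ + C₁) * n * 2 ^ ⌊l / ll⌋₊)
          ≤ K * ((C₁ / C₄ + C₁) * n * (n : ℝ) ^ (1 / ll)) := by
            gcongr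
            refine two_pow_le_rpow (by omega) (hκle.trans (le_of_eq ?_))
            ring
        _ = K * (C₁ / C₄ + C₁) * (n * (n : ℝ) ^ (1 / ll)) := by ring
        _ ≤ _ := by gcongr
    · have hratio : (C₁ - 1 + 1) * l / (⌊l / ll⌋₊ : ℝ) ≤ 2 * C₁ * ll := by
        rw [div_le_iff₀ hκ0]
        calc (C₁ - 1 + 1) * l = 2 * C₁ * ll * (1 / 2 * (l / ll)) := by field_simp; ring
          _ ≤ _ := by
            gcongr
            linarith
      have hlog : max 1 (Real.logb 2 (2 * C₁ * ll)) ≤ 2 * Real.logb 2 ll := by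
        rw [Real.logb_mul (by positivity) hll0.ne']
        have h5 := (le_max_left _ _).trans h3
        have h6 := (le_max_right _ _).trans h3
        exact max_le (by linarith) (by linarith)
      calc _ ≤ K * max 1 (Real.logb 2 (2 * C₁ * ll)) := by
            refine mul_le_mul_of_nonneg_left ?_ hK0.le
            refine max_one_logb_le (div_nonneg ?_ hκ0.le) hratio
            exact mul_nonneg (by linarith) (by linarith)
        _ ≤ K * (2 * Real.logb 2 ll) := by gcongr
        _ = 2 * K * Real.logb 2 ll := by ring
        _ ≤ _ := by
            have h5 := (le_max_left _ _).trans h3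
            gcongr
  · simp only [one_div]
    exact tendsto_inv_atTop_zero.comp hll
  · filter_upwards [hreg, hDC 1 one_pos, hll.eventually_ge_atTop (max 1 (Real.logb 2 C₁)),
      hl.eventually_ge_atTop 1] with n hn hD h3 hl1 b x hx
    set l := Real.logb 2 (n : ℝ) with hldef
    have h5 := (le_max_left _ _).trans h3
    have h6 := (le_max_right _ _).trans h3
    refine isPredStructure_encodedReps hK0.le H hC₁ hC₄ hn le_rfl hD ?_ ?_ hx
    · calc K * ((C₁ / C₄ + C₁) * n * 2 ^ 1) = 2 * K * (C₁ / C₄ + C₁) * n := by ring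
        _ ≤ _ := by gcongr
    · have hlog : max 1 (Real.logb 2 ((C₁ - 1 + 1) * l / (1 : ℕ))) ≤ 2 * Real.logb 2 l := by
        rw [Nat.cast_one, div_one, sub_add_cancel, Real.logb_mul (by positivity) (by positivity)]
        exact max_le (by linarith) (by linarith)
      calc _ ≤ K * (2 * Real.logb 2 l) := by gcongr
        _ = 2 * K * Real.logb 2 l := by ring
        _ ≤ _ := by gcongr
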